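/- Let $\mathbb X$ be a Polish space with its Borel $\sigma$-algebra, let $1\le M<K$ be integers, and let $P_1,\dots,P_K$ be Markov transition kernels on $\mathbb X$ (the arms). For a set $\mathbf F$ of bounded measurable functions $\mathbb X\to\mathbb R$ put $\mathrm{IPM}_{\mathbf F}(\mu,\nu)=\sup_{f\in\mathbf F}\left|\int f\,d\mu-\int f\,d\nu\right|$. For every arm $i$ assume: (1) (drift condition) there are a measurable $V_i:\mathbb X\to[1,\infty)$, a constant $b_i\ge 0$ and a concave increasing function $\phi_i:[0,\infty)\to[0,\infty)$ with $\phi_i(0)=0$, differentiable on $(0,\infty)$ (increasing need not be strict), such that $P_iV_i\le V_i-\phi_i\circ V_i+b_i$; (2) (convergence in IPM) $P_i$ has a unique invariant probability measure $\pi_i$, and for a set $\mathbf F_i$ of bounded measurable functions, $\Gamma_{\mathbf F_i}:=\sup_{x\in\mathbb X}\sum_{k=1}^\infty \mathrm{IPM}_{\mathbf F_i}(P_i^k(x,\cdot),\pi_i)<\infty$; (3) (reward) the reward function $r_i:\mathbb X\to[0,\infty)$ lies in $R_i\cdot\mathbf F_i=\{R_if: f\in\mathbf F_i\}$ for some $R_i\in[0,\infty)$.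 Put $\eta_i=\int r_i\,d\pi_i$ and $\mathrm{sp}(r_i)=\sup r_i-\inf r_i$, and let the arms be ordered so that $\eta_1\ge\eta_2\ge\dots\ge\eta_K$. The state processes $(X_i(s))_{s\ge0}$, $i=1,\dots,K$, are independent Markov chains with kernels $P_i$ and arbitrary initial laws. The arms are rested: at each time $t=1,2,\dots$ a set $A(t)$ of $M$ arms is played, $T_i(t)$ is the number of times arm $i$ has been played up to time $t$, and playing $i\in A(t)$ yields the reward $r_i(X_i(T_i(t)))$. The algorithm UCB-M with exploration constant $L$ plays each arm exactly $M$ times during the first $K$ time steps ($M$ arms per step), and at each time $n+1$ with $n\ge K$ it plays $M$ arms with the highest indices $$h_i(n)=\frac1{T_i(n)}\sum_{s=1}^{T_i(n)}r_i(X_i(s))+\sqrt{\frac{L\log n}{T_i(n)}}.$$ The order in the initial phase and the breaking of ties are arbitrary (possibly randomized independently of the arms), but the choice of $A(n+1)$ may depend only on the choices made and states seen up to time $n$ (and on that randomization). Let $$L\ \ge\ \max_{1\le i\le K}\left(R_i\Gamma_{\mathbf F_i}+\mathrm{sp}(r_i)\right)^2\left(\frac1{\sqrt{\log K}}+2\sqrt2\right)^2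 .$$ Then for every $n$ the regret $\mathcal R(n)=n\sum_{j=1}^M\eta_j-\mathbb E\left[\sum_{t=1}^n\sum_{i\in A(t)}r_i(X_i(T_i(t)))\right]$ of UCB-M satisfies $$\mathcal R(n)\le 4L\log n\sum_{i>M}\frac{\eta_1-\eta_i}{(\eta_M-\eta_i)^2}+\sum_{i>M}(\eta_1-\eta_i)(1+2\beta)M+2\sum_{i=1}^KR_i\Gamma_{\mathbf F_i},\qquad \beta=\sum_{t=1}^\infty t^{-2}.$$ Here $a/0=+\infty$ for $a>0$, $0/0=0$, $0\cdot\infty=0$, and $\log 0=0$ for $n=0$, so ties $\eta_i=\eta_M$ with $i>M$ are allowed. -/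

import Mathlib

open MeasureTheory ProbabilityTheory
open scoped ENNReal Pointwise

noncomputable section

namespace RestedBandit

/-! ### Integral probability metrics and Markov chains -/

section Chains

variable {S : Type*} [MeasurableSpace S]

/-- The integral probability (pseudo)metric with generator `F`:
`sup_{f ∈ F} |∫ f dμ - ∫ f dν|`, with values in `[0, ∞]`. -/
def ipm (F : Set (S → ℝ)) (μ ν : Measure S) : ℝ≥0∞ :=
  ⨆ f ∈ F, ENNReal.ofReal |∫ x, f x ∂μ - ∫ x, f x ∂ν|

/-- The concentrability constant `sup_x ∑_{k ≥ 1} IPM_F(P^k(x, ·), π)`, with values in `[0, ∞]`. -/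
def concentrability (F : Set (S → ℝ)) (P : Kernel S S) (π : Measure S) : ℝ≥0∞ :=
  ⨆ x, ∑' k : ℕ, ipm F ((P ^ (k + 1)) x) π

/-- The span (oscillation) of a bounded function: the length of the smallest closed interval that
contains its range. -/
def span (f : S → ℝ) : ℝ := (⨆ x, f x) - ⨅ x, f x

/-- The class `F` consists of bounded measurable functions. -/
def IsBoundedClass (F : Set (S → ℝ)) : Prop :=
  ∀ f ∈ F, Measurable f ∧ ∃ C : ℝ, ∀ x, |f x| ≤ C

/-- `π` is the unique invariant probability measure of `P`. -/
def IsUniqueInvariant (P : Kernel S S) (π : Measure S) : Prop :=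
  IsProbabilityMeasure π ∧ P.Invariant π ∧
    ∀ ν : Measure S, IsProbabilityMeasure ν → P.Invariant ν → ν = π

/-- `P` converges in `IPM_F` to its unique invariant probability measure `π`. -/
def ConvergesInIPM (F : Set (S → ℝ)) (P : Kernel S S) (π : Measure S) : Prop :=
  IsUniqueInvariant P π ∧ concentrability F P π < ∞

/-- The subgeometric drift condition `P V ≤ V - φ ∘ V + b`: here `V ≥ 1` is measurable, and
`φ : [0, ∞) → [0, ∞)` is a differentiable concave increasing function with `φ 0 = 0`
(differentiability is only asked for in the interior, and monotonicity is not strict).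
That `P V` is finite is part of the condition. -/
def SubgeometricDrift (P : Kernel S S) : Prop :=
  ∃ (V : S → ℝ) (φ : ℝ → ℝ) (b : ℝ),
    Measurable V ∧ (∀ x, 1 ≤ V x) ∧
    (∀ u, 0 ≤ u → 0 ≤ φ u) ∧ φ 0 = 0 ∧
    DifferentiableOn ℝ φ (Set.Ioi 0) ∧ ConcaveOn ℝ (Set.Ici 0) φ ∧ MonotoneOn φ (Set.Ici 0) ∧
    0 ≤ b ∧
    ∀ x, Integrable V (P x) ∧ ∫ y, V y ∂(P x) ≤ V x - φ (V x) + b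

/-- `X` is a time-homogeneous Markov chain with transition kernel `P` on the probability space
`(Ω, μ)`: given `X 0, …, X n`, the conditional law of `X (n + 1)` is `P (X n, ·)`.
The law of `X 0` is arbitrary. -/
def IsMarkovChain {Ω : Type*} [MeasurableSpace Ω] (μ : Measure Ω) (P : Kernel S S)
    (X : ℕ → Ω → S) : Prop :=
  (∀ n, Measurable (X n)) ∧
    ∀ (n : ℕ) (B : Set S), MeasurableSet B →
      μ⟦X (n + 1) ⁻¹' B | ⨆ k : Fin (n + 1), MeasurableSpace.comap (X k) inferInstance⟧
        =ᵐ[μ] fun ω => (P (X n ω)).real B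

end Chains

/-! ### Rested bandits and the UCB-M algorithm

There are `K` arms; `X i s ω` is the state of arm `i` after its `s`-th pull (`X i 0` is its initial
state), and `A t ω` is the set of arms that are played at time `t = 1, 2, …`. -/

section Bandits

variable {Ω S : Type*} {K : ℕ}

/-- `T_i(n)`: the number of times that arm `i` is played up to time `n`. -/
def pulls (A : ℕ → Ω → Finset (Fin K)) (i : Fin K) (n : ℕ) (ω : Ω) : ℕ :=
  ∑ t ∈ Finset.Icc 1 n, if i ∈ A t ω then 1 else 0

/-- The average reward of arm `i` over its first `s` pulls. -/
def sampleMean (X : Fin K → ℕ → Ω → S) (r : Fin K → S → ℝ) (i : Fin K) (s : ℕ) (ω : Ω) : ℝ :=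
  (∑ t ∈ Finset.Icc 1 s, r i (X i t ω)) / s

/-- The UCB index `h_i(n)` of arm `i` at time `n`. -/
def ucbIndex (L : ℝ) (X : Fin K → ℕ → Ω → S) (r : Fin K → S → ℝ) (A : ℕ → Ω → Finset (Fin K))
    (i : Fin K) (n : ℕ) (ω : Ω) : ℝ :=
  sampleMean X r i (pulls A i n ω) ω + √(L * Real.log n / pulls A i n ω)

/-- The information available to the player after time `n`: the arms played at times `1, …, n`
and the states seen so far, namely `X i s` for all arms `i` and all `s ≤ T_i(n)`. -/
abbrev observed [MeasurableSpace S] (X : Fin K → ℕ → Ω → S) (A : ℕ → Ω → Finset (Fin K)) (n : ℕ) :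
    MeasurableSpace Ω :=
  (⨆ t ∈ Finset.Icc 1 n, MeasurableSpace.comap (A t) ⊤) ⊔
    ⨆ (i : Fin K) (s : ℕ),
      MeasurableSpace.comap (fun ω => X i (min s (pulls A i n ω)) ω) inferInstance

/-- `A` is a run of the UCB-M algorithm with exploration constant `L`: `M` arms are played at each
time, each arm is played exactly `M` times in the first `K` steps, and at each time `n + 1 > K` the
arms played are `M` arms with the highest indices `h_i(n)`. The order in the initial phase and the
breaking of ties are arbitrary, but must not look ahead: the decision at time `n + 1` depends
only on what has been observed up to time `n` and on the randomization `𝓤` of the player. -/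
structure IsUCBM [MeasurableSpace S] (M : ℕ) (L : ℝ) (X : Fin K → ℕ → Ω → S)
    (r : Fin K → S → ℝ) (𝓤 : MeasurableSpace Ω) (A : ℕ → Ω → Finset (Fin K)) : Prop where
  card_eq : ∀ t, 1 ≤ t → ∀ ω, (A t ω).card = M
  init : ∀ i ω, pulls A i K ω = M
  highest : ∀ n, K ≤ n → ∀ ω, ∀ i ∈ A (n + 1) ω, ∀ j ∉ A (n + 1) ω,
    ucbIndex L X r A j n ω ≤ ucbIndex L X r A i n ω
  nonanticipating : ∀ (n : ℕ) (C : Finset (Fin K)),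
    MeasurableSet[𝓤 ⊔ observed X A n] {ω | A (n + 1) ω = C}

/-- The regret up to time `n` with respect to always playing the first `M` arms, where `η i` is the
stationary expected reward of arm `i`. As the arms are rested, playing arm `i` at time `t` yields
the reward of the state `X i (T_i(t))`. -/
def regret [MeasurableSpace Ω] (μ : Measure Ω) (M : ℕ) (η : Fin K → ℝ) (X : Fin K → ℕ → Ω → S)
    (r : Fin K → S → ℝ) (A : ℕ → Ω → Finset (Fin K)) (n : ℕ) : ℝ :=
  n * (∑ j : Fin K with j.val < M, η j) -
    ∫ ω, ∑ t ∈ Finset.Icc 1 n, ∑ i ∈ A t ω, r i (X i (pulls A i t ω) ω) ∂μ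

end Bandits

end RestedBandit

end

/-! The pulls of arms outside the top `M` cost regret, and so does the bias from chains that are not
stationary. The finite-horizon Poisson equation controls the bias and also gives the concentration
behind the pull counts.

For `g = r i - η i` let `h_m = ∑_{j=1}^m P^j g`, the `potential`. Convergence in IPM gives `|h_m| ≤
R i * Γ i` uniformly in `m` and the state (`abs_potential_le`), and `h_{m+1} = P (g + h_m)`
(`potential_succ`). Hence `∑_{s ≤ k} g (X s) + h_{N-k} (X k)` is a martingale for `k ≤ N`.

Concentration: each increment has conditional range at most `sp (r i) + 2 R i Γ i`, so Hoeffding's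
lemma and Chernoff's bound apply (`measure_le_sum_le`). The lower bound on `L` makes a confidence
bound at time `t` fail with probability at most `t⁻⁴` (`measureReal_events_le`).

Bias: `T_i(n)` is a stopping time once the other arms and the randomization are revealed in advance
(`measurableSet_pulls_le`), and by independence this extra knowledge does not change the transitions
of arm `i` (`isTransition_armInformation`). Optional stopping leaves a start and an end potential
for each arm, hence the term `2 ∑ R i Γ i` (`regret_le`).

Counting: if an arm `i` outside the top `M` is played, some top arm is left out and has no larger
index. After `4 L log n / (ηM - η i)²` pulls of `i` this forces a confidence bound to fail
(`pulls_le_add_sum_failures`). Summing the failure probabilities gives the constant with `β`, and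
`sum_top_sub_le` turns pull counts into regret. -/

noncomputable section

namespace RestedBandit

/-! ### Transitions relative to a σ-algebra, and enlargement by independent information. -/

section Transition

variable {Ω S : Type*} {𝒢 𝓗 𝒦 : MeasurableSpace Ω} [mΩ : MeasurableSpace Ω] [MeasurableSpace S]
  {μ : Measure Ω} {P : Kernel S S}

theorem isPiSystem_image2_inter {α : Type*} (m₁ m₂ : MeasurableSpace α) :
    IsPiSystem (Set.image2 (· ∩ ·) {s | MeasurableSet[m₁] s} {s | MeasurableSet[m₂] s}) := by
  rintro _ ⟨s, hs, t, ht, rfl⟩ _ ⟨s', hs', t', ht', rfl⟩ -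
  exact ⟨s ∩ s', hs.inter hs', t ∩ t', ht.inter ht', Set.inter_inter_inter_comm s s' t t'⟩

theorem sup_eq_generateFrom_image2_inter {α : Type*} (m₁ m₂ : MeasurableSpace α) :
    m₁ ⊔ m₂ = MeasurableSpace.generateFrom
      (Set.image2 (· ∩ ·) {s | MeasurableSet[m₁] s} {s | MeasurableSet[m₂] s}) := by
  apply le_antisymm
  · refine sup_le (fun s hs => ?_) (fun s hs => ?_)
    · exact MeasurableSpace.measurableSet_generateFrom
        ⟨s, hs, Set.univ, MeasurableSet.univ, Set.inter_univ s⟩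
    · exact MeasurableSpace.measurableSet_generateFrom
        ⟨Set.univ, MeasurableSet.univ, s, hs, Set.univ_inter s⟩
  · refine MeasurableSpace.generateFrom_le ?_
    rintro _ ⟨s, hs, t, ht, rfl⟩
    exact MeasurableSet.inter ((le_sup_left : m₁ ≤ m₁ ⊔ m₂) s hs)
      ((le_sup_right : m₂ ≤ m₁ ⊔ m₂) t ht)

/-- Given the information `𝒢`, the conditional law of `Y'` is `P (Y, ·)`. -/
def IsTransition (μ : Measure Ω) (P : Kernel S S) (𝒢 : MeasurableSpace Ω) (Y Y' : Ω → S) : Prop :=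
  ∀ G, MeasurableSet[𝒢] G → ∀ B, MeasurableSet B →
    μ (G ∩ Y' ⁻¹' B) = ∫⁻ ω in G, P (Y ω) B ∂μ

/-- The states of a chain up to time `n`. -/
abbrev history {Ω S : Type*} [MeasurableSpace S] (X : ℕ → Ω → S) (n : ℕ) : MeasurableSpace Ω :=
  ⨆ k : Fin (n + 1), MeasurableSpace.comap (X k) inferInstance

theorem history_le {X : ℕ → Ω → S} (hX : ∀ n, Measurable (X n)) (n : ℕ) : history X n ≤ mΩ :=
  iSup_le fun k => (hX k).comap_le

theorem measurable_history {Ω S : Type*} [MeasurableSpace S] (X : ℕ → Ω → S) {k n : ℕ} (h : k ≤ n) :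
    Measurable[history X n] (X k) := by
  have : MeasurableSpace.comap (X k) inferInstance ≤ history X n :=
    le_iSup (fun j : Fin (n + 1) => MeasurableSpace.comap (X j) inferInstance)
      ⟨k, by omega⟩
  exact Measurable.mono (comap_measurable (X k)) this le_rfl

theorem IsMarkovChain.isTransition [IsProbabilityMeasure μ] [IsMarkovKernel P] {X : ℕ → Ω → S}
    (hX : IsMarkovChain μ P X) (n : ℕ) :
    IsTransition μ P (history X n) (X n) (X (n + 1)) := by
  intro G hG B hB
  have hle := history_le hX.1 n
  have hB' : MeasurableSet (X (n + 1) ⁻¹' B) := hX.1 (n + 1) hB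
  have hPm : Measurable fun ω => P (X n ω) B := (P.measurable_coe hB).comp (hX.1 n)
  have h1 : ∫ ω in G, (X (n + 1) ⁻¹' B).indicator (fun _ => (1 : ℝ)) ω ∂μ
      = ∫ ω in G, (P (X n ω)).real B ∂μ := by
    rw [← setIntegral_condExp hle ((integrable_const _).indicator hB') hG]
    refine setIntegral_congr_ae (hle _ hG) ?_
    filter_upwards [hX.2 n B hB] with ω hω _ using hω
  rw [integral_indicator hB', integral_const, smul_eq_mul, mul_one,
    Measure.real, Measure.restrict_apply_univ, Measure.restrict_apply hB'] at h1
  simp only [Measure.real] at h1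
  rw [integral_toReal hPm.aemeasurable (by simp)] at h1
  rw [Set.inter_comm]
  refine (ENNReal.toReal_eq_toReal_iff' (measure_ne_top _ _) ?_).1 h1
  refine ((lintegral_mono fun ω => prob_le_one).trans_lt (b := ∫⁻ _ in G, 1 ∂μ) ?_).ne
  simp

namespace IsTransition

variable {Y Y' : Ω → S}

/-- On a set `H ∩ A` with `H ∈ 𝓗` and `A ∈ 𝒢`, independence pulls the factor `μ H` out of both sides
and leaves the identity for `A`. Such sets form a π-system generating `𝓗 ⊔ 𝒢`. -/
theorem sup_of_indep [IsProbabilityMeasure μ] (h : IsTransition μ P 𝒢 Y Y')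
    (h𝓗 : 𝓗 ≤ mΩ) (h𝒦 : 𝒦 ≤ mΩ) (hind : Indep 𝓗 𝒦 μ) (h𝒢 : 𝒢 ≤ 𝒦) (hY : Measurable[𝒦] Y)
    (hY' : Measurable[𝒦] Y') : IsTransition μ P (𝓗 ⊔ 𝒢) Y Y' := by
  intro G hG B hB
  have hYm : Measurable Y := hY.mono h𝒦 le_rfl
  have hYm' : Measurable Y' := hY'.mono h𝒦 le_rfl
  have hPm : Measurable fun ω => P (Y ω) B := (P.measurable_coe hB).comp hYm
  have hPK : Measurable[𝒦] fun ω => P (Y ω) B := (P.measurable_coe hB).comp hY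
  have hm : 𝓗 ⊔ 𝒢 ≤ mΩ := sup_le h𝓗 (h𝒢.trans h𝒦)
  -- Both sides of the claim are finite measures in `G`; trimming to `𝓗 ⊔ 𝒢` allows the comparison
  -- on the π-system only.
  have key : (μ.restrict (Y' ⁻¹' B)).trim hm
      = (μ.withDensity fun ω => P (Y ω) B).trim hm := by
    have e1 : ∀ A, MeasurableSet[𝓗 ⊔ 𝒢] A →
        (μ.restrict (Y' ⁻¹' B)).trim hm A = μ (A ∩ Y' ⁻¹' B) := fun A hA => by
      rw [trim_measurableSet_eq hm hA, Measure.restrict_apply (hm _ hA)]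
    have e2 : ∀ A, MeasurableSet[𝓗 ⊔ 𝒢] A →
        (μ.withDensity fun ω => P (Y ω) B).trim hm A = ∫⁻ ω in A, P (Y ω) B ∂μ := fun A hA => by
      rw [trim_measurableSet_eq hm hA, withDensity_apply _ (hm _ hA)]
    refine @ext_of_generate_finite Ω (𝓗 ⊔ 𝒢) _ _ _ (sup_eq_generateFrom_image2_inter 𝓗 𝒢)
      (isPiSystem_image2_inter 𝓗 𝒢) inferInstance ?_ ?_
    · rintro _ ⟨H, hH, A, hA, rfl⟩
      have hHA : MeasurableSet[𝓗 ⊔ 𝒢] (H ∩ A) := MeasurableSet.inter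
        ((le_sup_left : 𝓗 ≤ 𝓗 ⊔ 𝒢) _ hH) ((le_sup_right : 𝒢 ≤ 𝓗 ⊔ 𝒢) _ hA)
      change MeasurableSet[𝓗] H at hH
      change MeasurableSet[𝒢] A at hA
      rw [e1 _ hHA, e2 _ hHA, Set.inter_assoc,
        (Indep_iff _ _ _).1 hind H (A ∩ Y' ⁻¹' B) hH ((h𝒢 _ hA).inter (hY' hB)), h A hA B hB,
        ← lintegral_indicator ((h𝓗 _ hH).inter (h𝒦 _ (h𝒢 _ hA))),
        ← lintegral_indicator (h𝒦 _ (h𝒢 _ hA))]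
      have := lintegral_mul_eq_lintegral_mul_lintegral_of_independent_measurableSpace h𝓗 h𝒦 hind
        (f := H.indicator 1) (g := A.indicator fun ω => P (Y ω) B)
        (Measurable.indicator (@measurable_const _ _ _ 𝓗 1) hH) (hPK.indicator (h𝒢 _ hA))
      rw [lintegral_indicator_one (h𝓗 _ hH)] at this
      rw [← this]
      congr 1 with ω
      by_cases h1 : ω ∈ H <;> by_cases h2 : ω ∈ A <;> simp [h1, h2]
    · rw [e1 _ MeasurableSet.univ, e2 _ MeasurableSet.univ]
      exact h _ MeasurableSet.univ B hB
  have := congrArg (fun ν => ν G) key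
  simpa only [trim_measurableSet_eq hm hG, Measure.restrict_apply (hm _ hG),
    withDensity_apply _ (hm _ hG)] using this

theorem map_restrict (h : IsTransition μ P 𝒢 Y Y') (hY : Measurable Y)
    (hY' : Measurable Y') {G : Set Ω} (hG : MeasurableSet[𝒢] G) :
    (μ.restrict G).map Y' = P ∘ₘ ((μ.restrict G).map Y) := by
  ext B hB
  rw [Measure.map_apply hY' hB, Measure.restrict_apply (hY' hB), Set.inter_comm, h G hG B hB,
    Measure.bind_apply hB P.aemeasurable, lintegral_map (P.measurable_coe hB) hY]

theorem setLIntegral (h : IsTransition μ P 𝒢 Y Y') (hY : Measurable Y)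
    (hY' : Measurable Y') {G : Set Ω} (hG : MeasurableSet[𝒢] G) {f : S → ℝ≥0∞}
    (hf : Measurable f) :
    ∫⁻ ω in G, f (Y' ω) ∂μ = ∫⁻ ω in G, ∫⁻ y, f y ∂(P (Y ω)) ∂μ := by
  rw [← lintegral_map hf hY', h.map_restrict hY hY' hG,
    Measure.lintegral_bind P.aemeasurable hf.aemeasurable,
    lintegral_map hf.lintegral_kernel hY]

theorem setIntegral [IsFiniteMeasure μ] [IsMarkovKernel P] (h : IsTransition μ P 𝒢 Y Y') (hY : Measurable Y)
    (hY' : Measurable Y') {G : Set Ω} (hG : MeasurableSet[𝒢] G) {f : S → ℝ}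
    (hf : Measurable f) {C : ℝ} (hC : ∀ x, |f x| ≤ C) :
    ∫ ω in G, f (Y' ω) ∂μ = ∫ ω in G, ∫ y, f y ∂(P (Y ω)) ∂μ := by
  have hb : ∀ x, ‖f x‖ ≤ C := hC
  rw [← integral_map hY'.aemeasurable hf.aestronglyMeasurable, h.map_restrict hY hY' hG,
    Measure.comp_eq_comp_const_apply,
    Kernel.integral_comp (Integrable.of_bound hf.aestronglyMeasurable C (.of_forall hb)),
    Kernel.const_apply, integral_map hY.aemeasurable hf.stronglyMeasurable.integral_kernel.aestronglyMeasurable]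

/-- The factor `Z` is known under `𝒢` and can be pulled out: the densities `f (Y')` and `P f (Y)`
define the same measure on `𝒢`. -/
theorem lintegral_mul (h : IsTransition μ P 𝒢 Y Y') (h𝒢 : 𝒢 ≤ mΩ) (hY : Measurable Y)
    (hY' : Measurable Y') {Z : Ω → ℝ≥0∞} (hZ : Measurable[𝒢] Z) {f : S → ℝ≥0∞}
    (hf : Measurable f) :
    ∫⁻ ω, Z ω * f (Y' ω) ∂μ = ∫⁻ ω, Z ω * ∫⁻ y, f y ∂(P (Y ω)) ∂μ := by
  have key : (μ.withDensity fun ω => f (Y' ω)).trim h𝒢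
      = (μ.withDensity fun ω => ∫⁻ y, f y ∂(P (Y ω))).trim h𝒢 := by
    refine @Measure.ext _ 𝒢 _ _ fun G hG => ?_
    rw [trim_measurableSet_eq h𝒢 hG, trim_measurableSet_eq h𝒢 hG,
      withDensity_apply _ (h𝒢 _ hG), withDensity_apply _ (h𝒢 _ hG),
      h.setLIntegral hY hY' hG hf]
  have hZ' : Measurable Z := hZ.mono h𝒢 le_rfl
  have e1 := lintegral_withDensity_eq_lintegral_mul μ (hf.comp hY') hZ'
  have e2 := lintegral_withDensity_eq_lintegral_mul μ ((hf.lintegral_kernel (κ := P)).comp hY) hZ'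
  simp only [Pi.mul_apply, Function.comp_apply, mul_comm _ (Z _)] at e1 e2
  rw [← e1, ← e2, ← lintegral_trim h𝒢 hZ, ← lintegral_trim h𝒢 hZ]
  exact congrArg (fun ν => @lintegral _ 𝒢 ν Z) key

end IsTransition

end Transition

/-! ### The potential, its Poisson equation and its exponential moments. -/

section Potential

variable {S : Type*} [MeasurableSpace S] {P : Kernel S S} {g : S → ℝ}

/-- The expected sum of `g` over the next `m` states of a chain with kernel `P`. -/
def potential (P : Kernel S S) (g : S → ℝ) (m : ℕ) (x : S) : ℝ :=
  ∑ j ∈ Finset.range m, ∫ y, g y ∂((P ^ (j + 1)) x)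

@[simp]
theorem potential_zero (P : Kernel S S) (g : S → ℝ) (x : S) : potential P g 0 x = 0 := by
  simp [potential]

theorem measurable_potential (P : Kernel S S) (hg : Measurable g) (m : ℕ) :
    Measurable (potential P g m) :=
  Finset.measurable_sum _ fun _ _ => hg.stronglyMeasurable.integral_kernel.measurable

theorem potential_neg (P : Kernel S S) (g : S → ℝ) (m : ℕ) (x : S) :
    potential P (fun y => -g y) m x = -potential P g m x := by
  simp [potential, integral_neg]

theorem isMarkovKernel_pow (P : Kernel S S) [IsMarkovKernel P] (k : ℕ) :
    IsMarkovKernel (P ^ k) := by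
  induction k with
  | zero => rw [pow_zero]; exact inferInstanceAs (IsMarkovKernel Kernel.id)
  | succ k ih => rw [pow_succ]; exact inferInstanceAs (IsMarkovKernel ((P ^ k) ∘ₖ P))

theorem integrable_of_abs_le {α : Type*} [MeasurableSpace α] {ν : Measure α} [IsFiniteMeasure ν]
    {f : α → ℝ} (hf : Measurable f) {C : ℝ} (hC : ∀ x, |f x| ≤ C) : Integrable f ν :=
  Integrable.of_bound hf.aestronglyMeasurable C (.of_forall hC)

/-- The finite-horizon Poisson equation, from `P ^ (j + 2) = P ^ (j + 1) ∘ P`. A finite horizon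
avoids any question of convergence of the infinite series. -/
theorem potential_succ [IsMarkovKernel P] (hg : Measurable g) {C : ℝ} (hC : ∀ x, |g x| ≤ C)
    (m : ℕ) (x : S) :
    potential P g (m + 1) x = ∫ y, (g y + potential P g m y) ∂(P x) := by
  have hint : ∀ j, Integrable (fun y => ∫ z, g z ∂((P ^ (j + 1)) y)) (P x) := fun j => by
    have := isMarkovKernel_pow P (j + 1)
    refine integrable_of_abs_le hg.stronglyMeasurable.integral_kernel.measurable (C := C)
      fun y => ?_
    simpa using norm_integral_le_of_norm_le_const (μ := (P ^ (j + 1)) y) (f := g) (.of_forall hC)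
  simp only [potential]
  rw [integral_add (integrable_of_abs_le hg hC) (integrable_finsetSum _ fun j _ => hint j),
    integral_finsetSum _ fun j _ => hint j, Finset.sum_range_succ', add_comm, zero_add, pow_one]
  congr 1
  refine Finset.sum_congr rfl fun j _ => ?_
  have := isMarkovKernel_pow P (j + 1)
  rw [pow_succ P (j + 1)]
  exact Kernel.integral_comp (κ := P) (η := P ^ (j + 1)) (integrable_of_abs_le (ν :=
    ((P ^ (j + 1)) ∘ₖ P) x) hg hC)

/-- Hoeffding's lemma under `P x`: the mean of `g + h_m` is `h_{m+1} x`, and its range lies in an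
interval of length `b - a + 2 * ρ`. -/
theorem lintegral_exp_potential_le [IsMarkovKernel P] (hg : Measurable g) {a b ρ B : ℝ}
    (hab : ∀ x, g x ∈ Set.Icc a b) (hρ : ∀ m x, |potential P g m x| ≤ ρ)
    (hB : b - a + 2 * ρ ≤ 2 * B) (l : ℝ) (m : ℕ) (x : S) :
    ∫⁻ y, ENNReal.ofReal (Real.exp (l * (g y + potential P g m y))) ∂(P x) ≤
      ENNReal.ofReal (Real.exp (l ^ 2 * B ^ 2 / 2)) *
        ENNReal.ofReal (Real.exp (l * potential P g (m + 1) x)) := by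
  have hC : ∀ x, |g x| ≤ max |a| |b| := fun x => abs_le_max_abs_abs (hab x).1 (hab x).2
  have hu : Measurable fun y => g y + potential P g m y := hg.add (measurable_potential P hg m)
  have hu' : ∀ y, g y + potential P g m y ∈ Set.Icc (a - ρ) (b + ρ) := fun y => by
    have h1 := abs_le.1 (hρ m y)
    exact ⟨by linarith [(hab y).1], by linarith [(hab y).2]⟩
  have hsub := hasSubgaussianMGF_of_mem_Icc (μ := P x) hu.aemeasurable (.of_forall hu')
  have h2 := hsub.mgf_le l
  have h3 := hsub.integrable_exp_mul l
  rw [← potential_succ hg hC] at h2 h3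
  rw [mgf] at h2
  have hlen : (‖b + ρ - (a - ρ)‖ / 2) ^ 2 ≤ B ^ 2 := by
    have h0 : 0 ≤ b + ρ - (a - ρ) := by linarith [(hu' x).1, (hu' x).2]
    rw [Real.norm_of_nonneg h0]
    exact pow_le_pow_left₀ (by linarith) (by linarith) 2
  have h4 : ∫ y, Real.exp (l * (g y + potential P g m y - potential P g (m + 1) x)) ∂(P x) ≤
      Real.exp (l ^ 2 * B ^ 2 / 2) := by
    refine h2.trans (Real.exp_le_exp.2 ?_)
    push_cast
    nlinarith [mul_le_mul_of_nonneg_right hlen (sq_nonneg l)]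
  have h5 : ∀ y, ENNReal.ofReal (Real.exp (l * (g y + potential P g m y))) =
      ENNReal.ofReal (Real.exp (l * potential P g (m + 1) x)) *
      ENNReal.ofReal
        (Real.exp (l * (g y + potential P g m y - potential P g (m + 1) x))) := fun y => by
    rw [← ENNReal.ofReal_mul (Real.exp_pos _).le, ← Real.exp_add]
    congr 2
    ring
  simp_rw [h5]
  rw [lintegral_const_mul _ (by fun_prop), mul_comm,
    ← ofReal_integral_eq_lintegral_ofReal h3 (.of_forall fun y => (Real.exp_pos _).le)]
  gcongr

end Potential

/-! ### Azuma–Hoeffding bound and optional stopping for additive functionals of a chain. -/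

section Concentration

variable {Ω S : Type*} {𝒢 : ℕ → MeasurableSpace Ω} [mΩ : MeasurableSpace Ω] [MeasurableSpace S]
  {μ : Measure Ω} {P : Kernel S S} {X : ℕ → Ω → S} {g : S → ℝ}

theorem IsMarkovChain.lintegral_exp_sum_le [IsProbabilityMeasure μ] [IsMarkovKernel P]
    (hX : IsMarkovChain μ P X) (hg : Measurable g) {a b ρ B : ℝ}
    (hab : ∀ x, g x ∈ Set.Icc a b) (hρ : ∀ m x, |potential P g m x| ≤ ρ)
    (hB : b - a + 2 * ρ ≤ 2 * B) (l : ℝ) (k m : ℕ) :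
    ∫⁻ ω, ENNReal.ofReal (Real.exp
        (l * (∑ s ∈ Finset.Icc 1 k, g (X s ω) + potential P g m (X k ω)))) ∂μ ≤
      ENNReal.ofReal (Real.exp (k * (l ^ 2 * B ^ 2 / 2) + |l| * ρ)) := by
  -- Removing the last state lengthens the remaining horizon by one, so `m` must vary. At `k = 0`
  -- only a potential of the initial state is left, which gives `|l| * ρ`.
  induction k generalizing m with
  | zero =>
    have : ∀ ω, ENNReal.ofReal (Real.exp
        (l * (∑ s ∈ Finset.Icc 1 0, g (X s ω) + potential P g m (X 0 ω)))) ≤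
        ENNReal.ofReal (Real.exp (((0 : ℕ) : ℝ) * (l ^ 2 * B ^ 2 / 2) + |l| * ρ)) := fun ω => by
      refine ENNReal.ofReal_le_ofReal (Real.exp_le_exp.2 ?_)
      simp only [Finset.Icc_eq_empty_of_lt Nat.zero_lt_one, Finset.sum_empty, zero_add,
        Nat.cast_zero, zero_mul]
      refine (le_abs_self _).trans ?_
      rw [abs_mul]
      exact mul_le_mul_of_nonneg_left (hρ m _) (abs_nonneg l)
    refine (lintegral_mono this).trans ?_
    simp
  | succ k ih =>
    have hZ : Measurable[history X k] fun ω =>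
        ENNReal.ofReal (Real.exp (l * ∑ s ∈ Finset.Icc 1 k, g (X s ω))) := by
      refine ENNReal.measurable_ofReal.comp (Real.measurable_exp.comp (Measurable.const_mul ?_ l))
      exact Finset.measurable_sum _ fun s hs =>
        hg.comp (measurable_history X (Finset.mem_Icc.1 hs).2)
    have hf : Measurable fun y => ENNReal.ofReal (Real.exp (l * (g y + potential P g m y))) := by
      have := measurable_potential P hg m
      fun_prop
    have key := (hX.isTransition k).lintegral_mul (history_le hX.1 k) (hX.1 k) (hX.1 (k + 1)) hZ hf
    calc
      _ = ∫⁻ ω, ENNReal.ofReal (Real.exp (l * ∑ s ∈ Finset.Icc 1 k, g (X s ω))) *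
            ENNReal.ofReal (Real.exp (l * (g (X (k + 1) ω) + potential P g m (X (k + 1) ω)))) ∂μ := by
          congr 1 with ω
          rw [← ENNReal.ofReal_mul (Real.exp_pos _).le, ← Real.exp_add,
            Finset.sum_Icc_succ_top (by omega)]
          congr 2
          ring
      _ ≤ ∫⁻ ω, ENNReal.ofReal (Real.exp (l ^ 2 * B ^ 2 / 2)) * ENNReal.ofReal (Real.exp
            (l * (∑ s ∈ Finset.Icc 1 k, g (X s ω) + potential P g (m + 1) (X k ω)))) ∂μ := by
          rw [key]
          refine lintegral_mono fun ω => ?_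
          refine (mul_le_mul_right (lintegral_exp_potential_le hg hab hρ hB l m (X k ω)) _).trans
            (le_of_eq ?_)
          rw [mul_left_comm, ← ENNReal.ofReal_mul (Real.exp_pos (l * Finset.sum _ _)).le,
            ← Real.exp_add, ← mul_add]
      _ ≤ _ := by
          rw [lintegral_const_mul']
          · refine (mul_le_mul_right (ih (m + 1)) _).trans (le_of_eq ?_)
            rw [← ENNReal.ofReal_mul (Real.exp_pos _).le, ← Real.exp_add]
            congr 2
            push_cast
            ring
          · exact ENNReal.ofReal_ne_top

theorem IsMarkovChain.measure_le_sum_le [IsProbabilityMeasure μ] [IsMarkovKernel P]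
    (hX : IsMarkovChain μ P X) (hg : Measurable g) {a b ρ B : ℝ}
    (hab : ∀ x, g x ∈ Set.Icc a b) (hρ : ∀ m x, |potential P g m x| ≤ ρ)
    (hB : b - a + 2 * ρ ≤ 2 * B) {n : ℕ} (hn : 1 ≤ n) (hB0 : 0 < B) {δ : ℝ} (hδ : 0 ≤ δ) :
    μ {ω | ρ + δ ≤ ∑ s ∈ Finset.Icc 1 n, g (X s ω)} ≤
      ENNReal.ofReal (Real.exp (-(δ ^ 2 / (2 * n * B ^ 2)))) := by
  have hn' : (0 : ℝ) < n := by exact_mod_cast hn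
  -- The minimizer of the Chernoff exponent `n l² B² / 2 - l δ`; the shift `ρ` in the threshold
  -- cancels the initial term `|l| * ρ`.
  set l : ℝ := δ / (n * B ^ 2) with hl
  have hl0 : 0 ≤ l := by positivity
  have h1 := hX.lintegral_exp_sum_le hg hab hρ hB l n 0
  simp only [potential_zero, add_zero] at h1
  have hm : Measurable fun ω => ENNReal.ofReal (Real.exp
      (l * ∑ s ∈ Finset.Icc 1 n, g (X s ω))) := by
    have : Measurable fun ω => ∑ s ∈ Finset.Icc 1 n, g (X s ω) :=
      Finset.measurable_sum _ fun s _ => hg.comp (hX.1 s)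
    fun_prop
  have h2 := (meas_ge_le_lintegral_div hm.aemeasurable
    (ε := ENNReal.ofReal (Real.exp (l * (ρ + δ)))) (by simp [Real.exp_pos])
    ENNReal.ofReal_ne_top).trans (ENNReal.div_le_div_right h1 _)
  refine (measure_mono fun ω hω => ?_).trans (h2.trans (le_of_eq ?_))
  · exact ENNReal.ofReal_le_ofReal (Real.exp_le_exp.2 (mul_le_mul_of_nonneg_left hω hl0))
  · rw [← ENNReal.ofReal_div_of_pos (Real.exp_pos _), ← Real.exp_sub, abs_of_nonneg hl0]
    congr 2
    rw [hl]
    field_simp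
    ring

/-- Optional stopping: the sum of `g` along a chain, up to a bounded stopping time. -/
theorem abs_integral_stopped_sum_le [IsProbabilityMeasure μ] [IsMarkovKernel P]
    (hX : ∀ s, Measurable (X s)) (h𝒢 : ∀ s, 𝒢 s ≤ mΩ)
    (hP : ∀ s, IsTransition μ P (𝒢 s) (X s) (X (s + 1))) (hg : Measurable g) {C : ℝ}
    (hC : ∀ x, |g x| ≤ C) {ρ : ℝ} (hρ : ∀ m x, |potential P g m x| ≤ ρ) {T : Ω → ℕ} {N : ℕ}
    (hTN : ∀ ω, T ω ≤ N) (hT : ∀ s, MeasurableSet[𝒢 s] {ω | T ω ≤ s}) :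
    Integrable (fun ω => ∑ s ∈ Finset.Icc 1 (T ω), g (X s ω)) μ ∧
      |∫ ω, ∑ s ∈ Finset.Icc 1 (T ω), g (X s ω) ∂μ| ≤ 2 * ρ := by
  have hset : ∀ s, MeasurableSet[𝒢 s] {ω | s < T ω} := fun s => by
    have := (hT s).compl
    rwa [show {ω | T ω ≤ s}ᶜ = {ω | s < T ω} by ext; simp] at this
  have hsum : ∀ (f : ℕ → ℝ) ω, ∑ s ∈ Finset.range N, (if s < T ω then f s else 0) =
      ∑ s ∈ Finset.range (T ω), f s := fun f ω => by
    rw [← Finset.sum_filter]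
    congr 1
    ext s
    simp only [Finset.mem_filter, Finset.mem_range]
    have := hTN ω
    omega
  have hS : ∀ ω, ∑ s ∈ Finset.Icc 1 (T ω), g (X s ω) =
      ∑ s ∈ Finset.range N, {ω | s < T ω}.indicator (fun ω => g (X (s + 1) ω)) ω := fun ω => by
    simp only [Set.indicator_apply, Set.mem_ofPred_eq]
    rw [hsum (fun s => g (X (s + 1) ω)) ω, Finset.range_eq_Ico,
      Finset.sum_Ico_add' (fun s => g (X s ω)) 0 (T ω) 1]
    rfl
  have hSint : Integrable (fun ω => ∑ s ∈ Finset.Icc 1 (T ω), g (X s ω)) μ := by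
    simp_rw [hS]
    exact integrable_finsetSum _ fun s _ => (integrable_of_abs_le (hg.comp (hX (s + 1)))
      (C := C) fun ω => hC _).indicator (h𝒢 s _ (hset s))
  refine ⟨hSint, ?_⟩
  let u : ℕ → S → ℝ := fun s y => g y + potential P g (N - (s + 1)) y
  -- The martingale increments. Stopped at `T` they have mean zero, and their potential parts
  -- telescope to the two boundary potentials.
  let D : ℕ → Ω → ℝ := fun s ω => u s (X (s + 1) ω) - potential P g (N - s) (X s ω)
  have hum : ∀ s, Measurable (u s) := fun s => hg.add (measurable_potential P hg _)
  have hub : ∀ s y, |u s y| ≤ C + ρ := fun s y =>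
    (abs_add_le _ _).trans (add_le_add (hC y) (hρ _ y))
  have hi1 : ∀ s, Integrable (fun ω => u s (X (s + 1) ω)) μ := fun s =>
    integrable_of_abs_le ((hum s).comp (hX (s + 1))) fun ω => hub s _
  have hi2 : ∀ s, Integrable (fun ω => potential P g (N - s) (X s ω)) μ := fun s =>
    integrable_of_abs_le ((measurable_potential P hg _).comp (hX s)) fun ω => hρ _ _
  have hDi : ∀ s, Integrable ({ω | s < T ω}.indicator (D s)) μ := fun s =>
    ((hi1 s).sub (hi2 s)).indicator (h𝒢 s _ (hset s))
  have hD0 : ∀ s ∈ Finset.range N, ∫ ω, {ω | s < T ω}.indicator (D s) ω ∂μ = 0 := fun s hs => by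
    rw [integral_indicator (h𝒢 s _ (hset s)), integral_sub (hi1 s).integrableOn
      (hi2 s).integrableOn, (hP s).setIntegral (hX s) (hX (s + 1)) (hset s) (hum s) (hub s),
      sub_eq_zero]
    congr 1 with ω
    rw [show N - s = N - (s + 1) + 1 by have := Finset.mem_range.1 hs; omega,
      potential_succ hg hC]
  have hDsum : ∫ ω, ∑ s ∈ Finset.range N, {ω | s < T ω}.indicator (D s) ω ∂μ = 0 := by
    rw [integral_finsetSum _ fun s _ => hDi s, Finset.sum_eq_zero hD0]
  have hpt : ∀ ω, ∑ s ∈ Finset.Icc 1 (T ω), g (X s ω) -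
      ∑ s ∈ Finset.range N, {ω | s < T ω}.indicator (D s) ω =
      potential P g N (X 0 ω) - potential P g (N - T ω) (X (T ω) ω) := fun ω => by
    have h1 : ∑ s ∈ Finset.range N, {ω | s < T ω}.indicator (D s) ω
        = ∑ s ∈ Finset.range (T ω), D s ω := by
      simp only [Set.indicator_apply, Set.mem_ofPred_eq]
      exact hsum (fun s => D s ω) ω
    have h2 : ∑ s ∈ Finset.Icc 1 (T ω), g (X s ω) = ∑ s ∈ Finset.range (T ω), g (X (s + 1) ω) := by
      rw [hS ω]
      simp only [Set.indicator_apply, Set.mem_ofPred_eq]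
      exact hsum (fun s => g (X (s + 1) ω)) ω
    have h3 := Finset.sum_range_sub' (fun s => potential P g (N - s) (X s ω)) (T ω)
    rw [h1, h2, ← Finset.sum_sub_distrib]
    rw [Nat.sub_zero] at h3
    rw [← h3]
    refine Finset.sum_congr rfl fun s _ => ?_
    simp only [D, u]
    ring
  have : ∫ ω, ∑ s ∈ Finset.Icc 1 (T ω), g (X s ω) ∂μ =
      ∫ ω, (potential P g N (X 0 ω) - potential P g (N - T ω) (X (T ω) ω)) ∂μ := by
    simp_rw [← hpt]
    rw [integral_sub hSint (integrable_finsetSum _ fun s _ => hDi s), hDsum, sub_zero]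
  rw [this]
  have hb := norm_integral_le_of_norm_le_const (μ := μ) (C := 2 * ρ)
    (f := fun ω => potential P g N (X 0 ω) - potential P g (N - T ω) (X (T ω) ω))
    (.of_forall fun ω => by
      refine (norm_sub_le _ _).trans ?_
      rw [two_mul]
      exact add_le_add (hρ _ _) (hρ _ _))
  simpa using hb

end Concentration

/-! ### Constants of a single arm. -/

section Arms

variable {Ω S : Type*} [mΩ : MeasurableSpace Ω] [MeasurableSpace S]
  {μ : Measure Ω} {P : Kernel S S} {X : ℕ → Ω → S} {r : S → ℝ}

theorem sum_abs_integral_sub_le {F : Set (S → ℝ)} {π : Measure S} {f : S → ℝ} (hf : f ∈ F)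
    (h : concentrability F P π < ∞) (m : ℕ) (x : S) :
    ∑ j ∈ Finset.range m, |∫ y, f y ∂((P ^ (j + 1)) x) - ∫ y, f y ∂π| ≤
      (concentrability F P π).toReal := by
  rw [← ENNReal.ofReal_le_iff_le_toReal h.ne, ENNReal.ofReal_sum_of_nonneg fun _ _ => abs_nonneg _]
  calc
    _ ≤ ∑ j ∈ Finset.range m, ipm F ((P ^ (j + 1)) x) π := by
        refine Finset.sum_le_sum fun j _ => ?_
        exact le_iSup₂ (f := fun f (_ : f ∈ F) =>
          ENNReal.ofReal |∫ y, f y ∂((P ^ (j + 1)) x) - ∫ y, f y ∂π|) f hf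
    _ ≤ ∑' j : ℕ, ipm F ((P ^ (j + 1)) x) π := ENNReal.sum_le_tsum _
    _ ≤ _ := le_iSup (fun x => ∑' j : ℕ, ipm F ((P ^ (j + 1)) x) π) x

theorem abs_potential_le [IsMarkovKernel P] {F : Set (S → ℝ)} {π : Measure S}
    [IsProbabilityMeasure π] (hF : IsBoundedClass F) (h : concentrability F P π < ∞)
    {R : ℝ} (hR : 0 ≤ R) (hr : r ∈ R • F) (m : ℕ) (x : S) :
    |potential P (fun y => r y - ∫ z, r z ∂π) m x| ≤ R * (concentrability F P π).toReal := by
  obtain ⟨f, hf, rfl⟩ := hr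
  obtain ⟨hfm, C, hC⟩ := hF f hf
  have : potential P (fun y => (R • f) y - ∫ z, (R • f) z ∂π) m x =
      ∑ j ∈ Finset.range m, R * (∫ y, f y ∂((P ^ (j + 1)) x) - ∫ y, f y ∂π) := by
    refine Finset.sum_congr rfl fun j _ => ?_
    have := isMarkovKernel_pow P (j + 1)
    simp only [Pi.smul_apply, smul_eq_mul]
    rw [integral_sub ((integrable_of_abs_le hfm hC).const_mul R) (integrable_const _),
      integral_const_mul, integral_const_mul]
    simp [mul_sub]
  simp only at this ⊢
  rw [this]
  refine (Finset.abs_sum_le_sum_abs _ _).trans ?_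
  simp_rw [abs_mul, abs_of_nonneg hR]
  rw [← Finset.mul_sum]
  exact mul_le_mul_of_nonneg_left (sum_abs_integral_sub_le hf h m x) hR

theorem measurable_bounded_of_mem_smul {F : Set (S → ℝ)} (hF : IsBoundedClass F) {R : ℝ}
    (hr : r ∈ R • F) : Measurable r ∧ ∃ C, ∀ x, |r x| ≤ C := by
  obtain ⟨f, hf, rfl⟩ := hr
  obtain ⟨hfm, C, hC⟩ := hF f hf
  refine ⟨hfm.const_smul R, |R| * C, fun x => ?_⟩
  simp only [Pi.smul_apply, smul_eq_mul, abs_mul]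
  exact mul_le_mul_of_nonneg_left (hC x) (abs_nonneg R)

theorem mem_Icc_iInf_iSup {α : Type*} {r : α → ℝ} {C : ℝ} (hC : ∀ x, |r x| ≤ C) (x : α) :
    r x ∈ Set.Icc (⨅ y, r y) (⨆ y, r y) :=
  ⟨ciInf_le ⟨-C, by rintro _ ⟨y, rfl⟩; exact (abs_le.1 (hC y)).1⟩ x,
    le_ciSup ⟨C, by rintro _ ⟨y, rfl⟩; exact (abs_le.1 (hC y)).2⟩ x⟩

theorem span_nonneg {α : Type*} [Nonempty α] {r : α → ℝ} {C : ℝ} (hC : ∀ x, |r x| ≤ C) :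
    0 ≤ span r := by
  obtain ⟨x⟩ := ‹Nonempty α›
  have := mem_Icc_iInf_iSup hC x
  exact sub_nonneg.2 (this.1.trans this.2)

/-- With `B = √L / c` and `c = 1 / √(log κ) + 2 √2`, the right side is `B c √(s log t)`. The first
summand of `c` absorbs `ρ ≤ B`, since `s log t ≥ log κ`; the second leaves exactly the deviation
term. -/
theorem sqrt_two_scale_le {κ t L ρ s : ℝ} (hκ : 1 < κ) (ht : κ ≤ t) (hs : 1 ≤ s)
    (hρ : ρ ≤ √L / (1 / √(Real.log κ) + 2 * √2)) :
    ρ + 2 * √2 * (√L / (1 / √(Real.log κ) + 2 * √2)) * √(s * Real.log t) ≤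
      √(s * (L * Real.log t)) := by
  have hlogκ : 0 < Real.log κ := Real.log_pos hκ
  have hlog : Real.log κ ≤ Real.log t := Real.log_le_log (by linarith) ht
  have hq : 0 < √(Real.log κ) := Real.sqrt_pos.2 hlogκ
  set c : ℝ := 1 / √(Real.log κ) + 2 * √2 with hc
  have hc0 : 0 < c := by positivity
  set B : ℝ := √L / c with hB
  have hB0 : 0 ≤ B := by positivity
  have hLB : √L = B * c := by rw [hB]; field_simp
  have h1 : √(s * (L * Real.log t)) = B * c * √(s * Real.log t) := by
    rw [show s * (L * Real.log t) = s * Real.log t * L by ring, Real.sqrt_mul (by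
      have := hlogκ.trans_le hlog; positivity), hLB, mul_comm]
  have h2 : 1 ≤ √(s * Real.log t) * (1 / √(Real.log κ)) := by
    rw [mul_one_div, one_le_div hq]
    refine Real.sqrt_le_sqrt ?_
    nlinarith
  rw [h1, hc]
  nlinarith [mul_le_mul_of_nonneg_left h2 hB0]

/-- The deviation `δ = 2 √2 B √(s log t)` makes the exponent `δ² / (2 s B²)` equal to `4 log t`,
whatever `s` is. Since `b - a ≥ 0`, `hbound` gives `b - a + 2 * ρ ≤ 2 * B`. -/
theorem IsMarkovChain.measure_sqrt_le_sum_le [IsProbabilityMeasure μ] [IsMarkovKernel P]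
    (hX : IsMarkovChain μ P X) {g : S → ℝ} (hg : Measurable g) {a b ρ L : ℝ}
    (hab : ∀ x, g x ∈ Set.Icc a b) (hρ : ∀ m x, |potential P g m x| ≤ ρ) {K s t : ℕ}
    (hK : 2 ≤ K) (ht : K ≤ t) (hs : 1 ≤ s) (hL : 0 < L)
    (hbound : ρ + (b - a) ≤ √L / (1 / √(Real.log K) + 2 * √2)) (hba : 0 ≤ b - a) :
    μ {ω | √(s * (L * Real.log t)) ≤ ∑ k ∈ Finset.Icc 1 s, g (X k ω)} ≤
      ENNReal.ofReal (1 / (t : ℝ) ^ 4) := by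
  have hK1 : (1 : ℝ) < K := by exact_mod_cast hK
  have htK : (K : ℝ) ≤ t := by exact_mod_cast ht
  have hs1 : (1 : ℝ) ≤ s := by exact_mod_cast hs
  have ht0 : (0 : ℝ) < t := by linarith
  have hlog : 0 ≤ Real.log t := Real.log_nonneg (by linarith)
  have hlogK : 0 < Real.log K := Real.log_pos hK1
  set B : ℝ := √L / (1 / √(Real.log K) + 2 * √2) with hB
  have hB0 : 0 < B := by positivity
  have h1 := sqrt_two_scale_le hK1 htK hs1 (L := L) (ρ := ρ) (by linarith)
  rw [← hB] at h1
  refine (measure_mono fun ω hω => h1.trans hω).trans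
    ((hX.measure_le_sum_le hg hab hρ (B := B) (by linarith) hs hB0
      (δ := 2 * √2 * B * √(s * Real.log t)) (by positivity)).trans (le_of_eq ?_))
  congr 1
  have h2 : (2 * √2 * B * √(s * Real.log t)) ^ 2 / (2 * s * B ^ 2) = 4 * Real.log t := by
    rw [mul_pow, Real.sq_sqrt (by positivity), mul_pow, mul_pow, Real.sq_sqrt (by norm_num)]
    field_simp
    ring
  rw [h2, Real.exp_neg, one_div, show (4 : ℝ) = ((4 : ℕ) : ℝ) by norm_num, Real.exp_nat_mul,
    Real.exp_log ht0]

end Arms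

/-! ### The filtration of one arm, in which its pull count is a stopping time. -/

section Information

variable {Ω S : Type*} {K : ℕ}

/-- What is known when arm `i` has been pulled `s` times and the other arms are fully known. -/
abbrev armInformation [MeasurableSpace S] (𝓤 : MeasurableSpace Ω) (X : Fin K → ℕ → Ω → S)
    (i : Fin K) (s : ℕ) : MeasurableSpace Ω :=
  𝓤 ⊔ ((⨆ j ∈ ({i}ᶜ : Set (Fin K)), ⨆ k, MeasurableSpace.comap (X j k) inferInstance) ⊔
    history (X i) s)

theorem armInformation_le {𝓤 : MeasurableSpace Ω} [mΩ : MeasurableSpace Ω] [MeasurableSpace S]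
    (h𝓤 : 𝓤 ≤ mΩ) {X : Fin K → ℕ → Ω → S} (hX : ∀ i n, Measurable (X i n)) (i : Fin K) (s : ℕ) :
    armInformation 𝓤 X i s ≤ mΩ :=
  sup_le h𝓤 (sup_le (iSup₂_le fun j _ => iSup_le fun k => (hX j k).comap_le)
    (history_le (hX i) s))

/-- Two independent enlargements of the arm's own history: by the other arms, then by the
randomization `𝓤`, which is independent of all arms together. -/
theorem isTransition_armInformation {𝓤 : MeasurableSpace Ω} [mΩ : MeasurableSpace Ω]
    [MeasurableSpace S] {μ : Measure Ω} [IsProbabilityMeasure μ] {P : Kernel S S}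
    [IsMarkovKernel P] {X : Fin K → ℕ → Ω → S} (hX : ∀ i n, Measurable (X i n))
    (hX_indep : iIndepFun (fun i ω n => X i n ω) μ) (h𝓤 : 𝓤 ≤ mΩ)
    (h𝓤_indep : Indep 𝓤 (⨆ (i : Fin K) (n : ℕ), MeasurableSpace.comap (X i n) inferInstance) μ)
    (i : Fin K) (hchain : IsMarkovChain μ P (X i)) (s : ℕ) :
    IsTransition μ P (armInformation 𝓤 X i s) (X i s) (X i (s + 1)) := by
  let m : Fin K → MeasurableSpace Ω := fun j => ⨆ k, MeasurableSpace.comap (X j k) inferInstance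
  have hm : ∀ j, m j ≤ mΩ := fun j => iSup_le fun k => (hX j k).comap_le
  have hcomap : ∀ j, MeasurableSpace.comap (fun ω n => X j n ω) MeasurableSpace.pi = m j :=
    fun j => by
      simp only [MeasurableSpace.pi, MeasurableSpace.comap_iSup, MeasurableSpace.comap_comp, m]
      rfl
  have hind : iIndep m μ := by
    have := (iIndepFun_iff_iIndep _ _ _).1 hX_indep
    simp only [hcomap] at this
    exact this
  have hmi : ∀ k, Measurable[m i] (X i k) := fun k =>
    Measurable.mono (comap_measurable (X i k))
      (le_iSup (fun k => MeasurableSpace.comap (X i k) inferInstance) k) le_rfl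
  have hhist : history (X i) s ≤ m i := iSup_le fun k =>
    le_iSup (fun k => MeasurableSpace.comap (X i k) inferInstance) (k : ℕ)
  have hdisj := indep_iSup_of_disjoint hm hind (S := {i}ᶜ) (T := {i}) disjoint_compl_left
  have hsing : (⨆ j ∈ ({i} : Set (Fin K)), m j) = m i := by simp
  rw [hsing] at hdisj
  have h1 := (hchain.isTransition s).sup_of_indep
    (iSup₂_le fun j _ => hm j) (hm i) hdisj hhist (hmi s) (hmi (s + 1))
  have hall : ∀ j, m j ≤ ⨆ j, m j := fun j => le_iSup m j
  exact h1.sup_of_indep h𝓤 (iSup_le hm) h𝓤_indep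
    (sup_le (iSup₂_le fun j _ => hall j) (hhist.trans (hall i)))
    ((hmi s).mono (hall i) le_rfl) ((hmi (s + 1)).mono (hall i) le_rfl)

/-- The σ-algebra of the sets whose trace on `E` is `m`-measurable. -/
abbrev traceSpace (m : MeasurableSpace Ω) (E : Set Ω) (hE : MeasurableSet[m] E) :
    MeasurableSpace Ω where
  MeasurableSet' H := MeasurableSet[m] (E ∩ H)
  measurableSet_empty := by simp
  measurableSet_compl H hH := by
    have : E ∩ Hᶜ = E \ (E ∩ H) := by ext; simp
    rw [this]
    exact hE.diff hH
  measurableSet_iUnion f hf := by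
    rw [Set.inter_iUnion]
    exact MeasurableSet.iUnion hf

theorem le_traceSpace {m m' : MeasurableSpace Ω} (h : m' ≤ m) {E : Set Ω}
    (hE : MeasurableSet[m] E) : m' ≤ traceSpace m E hE :=
  fun _ hH => hE.inter (h _ hH)

/-- Along a fixed path of choices the pull counts are deterministic, so what the player has seen by
time `n` involves at most the first `s` pulls of arm `i`. -/
theorem measurableSet_path [MeasurableSpace S] {𝓤 : MeasurableSpace Ω} {X : Fin K → ℕ → Ω → S}
    {A : ℕ → Ω → Finset (Fin K)}
    (hA : ∀ n C, MeasurableSet[𝓤 ⊔ observed X A n] {ω | A (n + 1) ω = C}) (i : Fin K) (s : ℕ)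
    (C : ℕ → Finset (Fin K)) (n : ℕ)
    (hC : ∑ t ∈ Finset.Icc 1 n, (if i ∈ C t then 1 else 0) ≤ s) :
    MeasurableSet[armInformation 𝓤 X i s] {ω | ∀ t ∈ Finset.Icc 1 n, A t ω = C t} := by
  induction n with
  | zero => simp
  | succ n ih =>
    rw [Finset.sum_Icc_succ_top (by omega)] at hC
    have hE := ih (by omega)
    set E := {ω | ∀ t ∈ Finset.Icc 1 n, A t ω = C t} with hEdef
    have hset : {ω | ∀ t ∈ Finset.Icc 1 (n + 1), A t ω = C t} =
        E ∩ {ω | A (n + 1) ω = C (n + 1)} := by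
      ext ω
      simp only [hEdef, Set.mem_ofPred_eq, Set.mem_inter_iff, Finset.mem_Icc]
      constructor
      · exact fun h => ⟨fun t ht => h t ⟨ht.1, by omega⟩, h (n + 1) ⟨by omega, le_rfl⟩⟩
      · rintro ⟨h1, h2⟩ t ⟨ht1, ht2⟩
        rcases Nat.lt_or_ge n t with h | h
        · obtain rfl : t = n + 1 := by omega
          exact h2
        · exact h1 t ⟨ht1, h⟩
    rw [hset]
    have hpulls : ∀ ω ∈ E, ∀ j, pulls A j n ω =
        ∑ t ∈ Finset.Icc 1 n, (if j ∈ C t then 1 else 0) := fun ω hω j =>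
      Finset.sum_congr rfl fun t ht => by rw [hω t ht]
    -- On `E` each past choice is constant and each observed state is `X j k` with `k` fixed. So the
    -- observed σ-algebra need only be compared with `armInformation` on `E`.
    suffices h : 𝓤 ⊔ observed X A n ≤ traceSpace (armInformation 𝓤 X i s) E hE from
      h _ (hA n (C (n + 1)))
    refine sup_le (le_traceSpace le_sup_left hE) (sup_le ?_ ?_)
    · refine iSup₂_le fun t ht => ?_
      rintro _ ⟨D, -, rfl⟩
      change MeasurableSet[armInformation 𝓤 X i s] (E ∩ A t ⁻¹' D)
      by_cases hD : C t ∈ D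
      · rw [Set.inter_eq_left.2 fun ω hω => by rw [Set.mem_preimage, hω t ht]; exact hD]
        exact hE
      · rw [Set.disjoint_iff_inter_eq_empty.1 (Set.disjoint_left.2 fun ω hω h => hD (by
          rw [Set.mem_preimage, hω t ht] at h; exact h))]
        exact @MeasurableSet.empty _ (armInformation 𝓤 X i s)
    · refine iSup₂_le fun j s' => ?_
      rintro _ ⟨D, hD, rfl⟩
      change MeasurableSet[armInformation 𝓤 X i s]
        (E ∩ (fun ω => X j (min s' (pulls A j n ω)) ω) ⁻¹' D)
      set k := min s' (∑ t ∈ Finset.Icc 1 n, (if j ∈ C t then 1 else 0)) with hk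
      have heq : E ∩ (fun ω => X j (min s' (pulls A j n ω)) ω) ⁻¹' D = E ∩ X j k ⁻¹' D := by
        ext ω
        simp only [Set.mem_inter_iff, Set.mem_preimage, and_congr_right_iff]
        intro hω
        rw [hpulls ω hω j]
      rw [heq]
      refine hE.inter ?_
      by_cases hji : j = i
      · subst hji
        exact (le_sup_right.trans le_sup_right : history (X j) s ≤ armInformation 𝓤 X j s) _
          (measurable_history (X j) (by omega : k ≤ s) hD)
      · have hle : MeasurableSpace.comap (X j k) inferInstance ≤ armInformation 𝓤 X i s :=
          ((le_iSup (fun k => MeasurableSpace.comap (X j k) inferInstance) k).trans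
            (le_iSup₂ (f := fun j (_ : j ∈ ({i}ᶜ : Set (Fin K))) =>
              ⨆ k, MeasurableSpace.comap (X j k) inferInstance) j hji)).trans
            (le_sup_left.trans le_sup_right)
        exact hle _ ⟨D, hD, rfl⟩

theorem measurableSet_pulls_le [MeasurableSpace S] {𝓤 : MeasurableSpace Ω}
    {X : Fin K → ℕ → Ω → S} {A : ℕ → Ω → Finset (Fin K)}
    (hA : ∀ n C, MeasurableSet[𝓤 ⊔ observed X A n] {ω | A (n + 1) ω = C}) (i : Fin K) (n s : ℕ) :
    MeasurableSet[armInformation 𝓤 X i s] {ω | pulls A i n ω ≤ s} := by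
  -- Only times up to `n` matter, so paths are indexed by a finite type and the union over them is
  -- finite.
  let ext : (Fin (n + 1) → Finset (Fin K)) → ℕ → Finset (Fin K) := fun C t =>
    C (Fin.ofNat (n + 1) t)
  have : {ω | pulls A i n ω ≤ s} = ⋃ (C : Fin (n + 1) → Finset (Fin K))
      (_ : ∑ t ∈ Finset.Icc 1 n, (if i ∈ ext C t then 1 else 0) ≤ s),
      {ω | ∀ t ∈ Finset.Icc 1 n, A t ω = ext C t} := by
    have hext : ∀ ω, ∀ t ∈ Finset.Icc 1 n, A t ω = ext (fun k => A k ω) t := fun ω t ht => by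
      have : t % (n + 1) = t := Nat.mod_eq_of_lt (by have := (Finset.mem_Icc.1 ht).2; omega)
      simp [ext, Fin.ofNat, this]
    ext ω
    simp only [Set.mem_iUnion, Set.mem_ofPred_eq, exists_prop]
    constructor
    · intro h
      refine ⟨fun k => A k ω, ?_, hext ω⟩
      rw [Finset.sum_congr rfl fun t ht => by rw [← hext ω t ht]]
      exact h
    · rintro ⟨C, hC, h⟩
      rwa [pulls, Finset.sum_congr rfl fun t ht => by rw [h t ht]]
  rw [this]
  exact MeasurableSet.iUnion fun C => MeasurableSet.iUnion fun hC =>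
    measurableSet_path hA i s _ n hC

end Information

/-! ### Pull counts. -/

section Pulls

variable {Ω S : Type*} {K M : ℕ} {A : ℕ → Ω → Finset (Fin K)}

theorem pulls_succ (A : ℕ → Ω → Finset (Fin K)) (i : Fin K) (n : ℕ) (ω : Ω) :
    pulls A i (n + 1) ω = pulls A i n ω + if i ∈ A (n + 1) ω then 1 else 0 := by
  rw [pulls, Finset.sum_Icc_succ_top (by omega)]
  rfl

@[simp]
theorem pulls_zero (A : ℕ → Ω → Finset (Fin K)) (i : Fin K) (ω : Ω) : pulls A i 0 ω = 0 := rfl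

theorem pulls_mono (A : ℕ → Ω → Finset (Fin K)) (i : Fin K) (ω : Ω) :
    Monotone fun n => pulls A i n ω :=
  monotone_nat_of_le_succ fun n => by rw [pulls_succ]; omega

theorem pulls_le (A : ℕ → Ω → Finset (Fin K)) (i : Fin K) (n : ℕ) (ω : Ω) :
    pulls A i n ω ≤ n := by
  induction n with
  | zero => simp
  | succ n ih =>
    rw [pulls_succ]
    split_ifs <;> omega

theorem sum_weight_mul_pulls_succ (η : Fin K → ℝ) (n : ℕ) (ω : Ω) :
    ∑ i, η i * (pulls A i (n + 1) ω : ℝ) =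
      ∑ i, η i * (pulls A i n ω : ℝ) + ∑ i ∈ A (n + 1) ω, η i := by
  rw [← Finset.sum_ite_mem_eq (A (n + 1) ω) η, ← Finset.sum_add_distrib]
  refine Finset.sum_congr rfl fun i _ => ?_
  rw [pulls_succ]
  split_ifs <;> push_cast <;> ring

theorem sum_pulls (hA : ∀ t, 1 ≤ t → ∀ ω, (A t ω).card = M) (n : ℕ) (ω : Ω) :
    ∑ i, (pulls A i n ω : ℝ) = n * M := by
  induction n with
  | zero => simp
  | succ n ih =>
    have := sum_weight_mul_pulls_succ (A := A) (fun _ => (1 : ℝ)) n ω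
    simp only [one_mul, Finset.sum_const, hA (n + 1) (by omega) ω, nsmul_eq_mul, mul_one] at this
    rw [this, ih]
    push_cast
    ring

/-- As the arms are rested, the pulls of arm `i` run through `s = 1, …, T_i(n)` without gaps, so
rewards can be regrouped by arm. -/
theorem sum_rewards_eq (f : Fin K → ℕ → ℝ) (n : ℕ) (ω : Ω) :
    ∑ t ∈ Finset.Icc 1 n, ∑ i ∈ A t ω, f i (pulls A i t ω) =
      ∑ i, ∑ s ∈ Finset.Icc 1 (pulls A i n ω), f i s := by
  induction n with
  | zero => simp
  | succ n ih =>
    rw [Finset.sum_Icc_succ_top (by omega), ih,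
      ← Finset.sum_ite_mem_eq (A (n + 1) ω) fun i => f i (pulls A i (n + 1) ω),
      ← Finset.sum_add_distrib]
    refine Finset.sum_congr rfl fun i _ => ?_
    rw [pulls_succ]
    split_ifs
    · rw [Finset.sum_Icc_succ_top (by omega)]
    · simp

end Pulls

/-! ### Deterministic comparison with the top `M` arms. -/

section Gaps

variable {K M : ℕ}

theorem card_filter_val_lt (hMK : M < K) : (Finset.univ.filter fun j : Fin K => j.val < M).card = M := by
  rw [Fin.card_filter_val_lt]
  omega

theorem sum_filter_lt_add_sum_filter_le (f : Fin K → ℝ) :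
    ∑ j : Fin K with j.val < M, f j + ∑ i : Fin K with M ≤ i.val, f i = ∑ i, f i := by
  simpa only [not_lt] using
    Finset.sum_filter_add_sum_filter_not Finset.univ (fun j : Fin K => j.val < M) f

/-- The pulls missing from the top arms, `n - T j`, add up to the pulls of the other arms; each
missing pull is valued at most at `η₁`. This is where `η₁ - η i` enters the regret. -/
theorem sum_top_sub_le (hMK : M < K) {η : Fin K → ℝ} {η₁ : ℝ}
    (hη₁ : ∀ i, η i ≤ η₁) {T : Fin K → ℝ} {n : ℝ} (hT : ∀ i, T i ≤ n)
    (hsum : ∑ i, T i = n * M) :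
    n * (∑ j : Fin K with j.val < M, η j) - ∑ i, η i * T i ≤
      ∑ i : Fin K with M ≤ i.val, (η₁ - η i) * T i := by
  have h1 := sum_filter_lt_add_sum_filter_le (M := M) T
  have h2 := sum_filter_lt_add_sum_filter_le (M := M) fun i => η i * T i
  have h3 : ∑ j : Fin K with j.val < M, η j * (n - T j) ≤
      ∑ j : Fin K with j.val < M, η₁ * (n - T j) :=
    Finset.sum_le_sum fun j _ => mul_le_mul_of_nonneg_right (hη₁ j) (sub_nonneg.2 (hT j))
  simp only [mul_sub, Finset.sum_sub_distrib, ← Finset.mul_sum, ← Finset.sum_mul,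
    Finset.sum_const, card_filter_val_lt hMK, nsmul_eq_mul] at h3
  simp only [sub_mul, Finset.sum_sub_distrib, ← Finset.mul_sum]
  have h4 : ∑ i : Fin K with M ≤ i.val, T i = n * M - ∑ j : Fin K with j.val < M, T j := by
    linarith
  rw [h4, ← h2]
  linarith [h3, mul_sub η₁ (n * M) (∑ j : Fin K with j.val < M, T j)]

/-- Exchange argument: `B \ C` and `C \ B` have equal size, and every element of the latter
dominates the best of the former. -/
theorem sum_le_sum_of_forall_le {ι : Type*} [DecidableEq ι] {η : ι → ℝ} {B C : Finset ι}
    (hcard : B.card = C.card) (h : ∀ i ∈ C, ∀ j ∉ C, η j ≤ η i) :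
    ∑ j ∈ B, η j ≤ ∑ i ∈ C, η i := by
  have hc : (B \ C).card = (C \ B).card := Finset.card_sdiff_comm hcard
  rw [← Finset.sum_inter_add_sum_sdiff B C, ← Finset.sum_inter_add_sum_sdiff C B,
    Finset.inter_comm C B]
  refine add_le_add le_rfl ?_
  rcases (B \ C).eq_empty_or_nonempty with h0 | h0
  · rw [h0] at hc ⊢
    rw [Finset.card_eq_zero.1 hc.symm]
  · obtain ⟨b, hb, hmax⟩ := Finset.exists_max_image _ η h0
    calc
      _ ≤ (B \ C).card • η b := Finset.sum_le_card_nsmul _ _ _ hmax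
      _ = (C \ B).card • η b := by rw [hc]
      _ ≤ _ := Finset.card_nsmul_le_sum _ _ _ fun i hi =>
        h i (Finset.mem_sdiff.1 hi).1 b (Finset.mem_sdiff.1 hb).2

theorem exists_lt_notMem (hMK : M < K) {C : Finset (Fin K)} (hC : C.card = M) {i : Fin K}
    (hi : i ∈ C) (hMi : M ≤ i.val) : ∃ j : Fin K, j.val < M ∧ j ∉ C := by
  by_contra! h
  have hsub : insert i (Finset.univ.filter fun j : Fin K => j.val < M) ⊆ C := by
    intro j hj
    rcases Finset.mem_insert.1 hj with rfl | hj
    · exact hi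
    · exact h j (Finset.mem_filter.1 hj).2
  have := Finset.card_le_card hsub
  rw [Finset.card_insert_of_notMem (by simp [hMi]), card_filter_val_lt hMK] at this
  omega

end Gaps

/-! ### Pathwise bound on the pulls of a suboptimal arm. -/

section Counting

variable {Ω S : Type*} [MeasurableSpace S] {K M : ℕ} {L : ℝ} {X : Fin K → ℕ → Ω → S}
  {r : Fin K → S → ℝ} {𝓤 : MeasurableSpace Ω} {A : ℕ → Ω → Finset (Fin K)}

/-- At time `t`, the index of arm `i` after `s` pulls does not exceed its true mean. -/
def lowEvent (L : ℝ) (X : Fin K → ℕ → Ω → S) (r : Fin K → S → ℝ) (η : Fin K → ℝ) (i : Fin K)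
    (s t : ℕ) : Set Ω :=
  {ω | sampleMean X r i s ω + √(L * Real.log t / s) ≤ η i}

/-- At time `t`, the sample mean of arm `i` after `s` pulls exceeds the true mean by the width of
the confidence interval. -/
def highEvent (L : ℝ) (X : Fin K → ℕ → Ω → S) (r : Fin K → S → ℝ) (η : Fin K → ℝ) (i : Fin K)
    (s t : ℕ) : Set Ω :=
  {ω | η i + √(L * Real.log t / s) ≤ sampleMean X r i s ω}

/-- The number of failing confidence bounds that can lead to arm `i` being played
after time `t`. -/
def failures (L : ℝ) (M : ℕ) (X : Fin K → ℕ → Ω → S) (r : Fin K → S → ℝ) (η : Fin K → ℝ)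
    (i : Fin K) (t : ℕ) (ω : Ω) : ℝ :=
  ∑ s ∈ Finset.Icc 1 t, (∑ j : Fin K with j.val < M, (lowEvent L X r η j s t).indicator 1 ω +
    (highEvent L X r η i s t).indicator 1 ω)

theorem failures_nonneg {Ω S : Type*} (L : ℝ) (M : ℕ) (X : Fin K → ℕ → Ω → S)
    (r : Fin K → S → ℝ) (η : Fin K → ℝ) (i : Fin K) (t : ℕ) (ω : Ω) :
    0 ≤ failures L M X r η i t ω :=
  Finset.sum_nonneg fun _ _ => add_nonneg
    (Finset.sum_nonneg fun _ _ => Set.indicator_nonneg (fun _ _ => zero_le_one) _)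
    (Set.indicator_nonneg (fun _ _ => zero_le_one) _)

theorem one_le_failures {Ω S : Type*} {X : Fin K → ℕ → Ω → S} {r : Fin K → S → ℝ}
    {η : Fin K → ℝ} {i : Fin K} {s t : ℕ} {ω : Ω} (hs : s ∈ Finset.Icc 1 t)
    (h : ω ∈ highEvent L X r η i s t ∨ ∃ j : Fin K, j.val < M ∧ ω ∈ lowEvent L X r η j s t) :
    1 ≤ failures L M X r η i t ω := by
  have h0 : ∀ (E : Set Ω), 0 ≤ E.indicator (1 : Ω → ℝ) ω := fun E =>
    Set.indicator_nonneg (fun _ _ => zero_le_one) _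
  refine le_trans ?_ (Finset.single_le_sum (f := fun s => ∑ j : Fin K with j.val < M,
    (lowEvent L X r η j s t).indicator (1 : Ω → ℝ) ω +
    (highEvent L X r η i s t).indicator 1 ω)
    (fun _ _ => add_nonneg (Finset.sum_nonneg fun _ _ => h0 _) (h0 _)) hs)
  rcases h with h | ⟨j, hj, h⟩
  · refine le_add_of_nonneg_of_le (Finset.sum_nonneg fun _ _ => h0 _) ?_
    simp [h]
  · refine le_add_of_le_of_nonneg ?_ (h0 _)
    refine le_trans ?_ (Finset.single_le_sum
      (f := fun j => (lowEvent L X r η j s t).indicator (1 : Ω → ℝ) ω)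
      (fun _ _ => h0 _) (Finset.mem_filter.2 ⟨Finset.mem_univ j, hj⟩))
    simp [h]

theorem IsUCBM.pulls_mem_Icc (hA : IsUCBM M L X r 𝓤 A) (hM : 1 ≤ M) {t : ℕ} (ht : K ≤ t)
    (i : Fin K) (ω : Ω) : pulls A i t ω ∈ Finset.Icc 1 t := by
  have := pulls_mono A i ω ht
  simp only [hA.init i ω] at this
  exact Finset.mem_Icc.2 ⟨by omega, pulls_le A i t ω⟩

theorem IsUCBM.pulls_le_add_sum_failures (hA : IsUCBM M L X r 𝓤 A) (hM : 1 ≤ M) (hMK : M < K)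
    (hL : 0 ≤ L) {η : Fin K → ℝ} {ηM : ℝ} (hηM : ∀ j : Fin K, j.val < M → ηM ≤ η j) {i : Fin K}
    (hi : M ≤ i.val) (hgap : η i < ηM) {N n : ℕ} (hKn : K ≤ n) (hnN : n ≤ N) (ω : Ω) :
    (pulls A i n ω : ℝ) ≤ 4 * L * Real.log N / (ηM - η i) ^ 2 + M +
      ∑ t ∈ Finset.Ico K n, failures L M X r η i t ω := by
  have hgap' : 0 < ηM - η i := sub_pos.2 hgap
  have hM' : (1 : ℝ) ≤ M := by exact_mod_cast hM
  have hx : 0 ≤ 4 * L * Real.log N / (ηM - η i) ^ 2 := by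
    have : 0 ≤ Real.log N := Real.log_natCast_nonneg N
    positivity
  -- The threshold uses the fixed horizon `N`, so it stays constant during the induction. Below it,
  -- one more pull is covered by `M ≥ 1`; above it, a pull is charged to a failure.
  induction n, hKn using Nat.le_induction with
  | base => rw [hA.init i ω]; simpa using hx
  | succ n hKn ih =>
    have ih := ih (by omega)
    have hf := failures_nonneg L M X r η i n ω
    rw [Finset.sum_Ico_succ_top hKn, pulls_succ]
    by_cases hiA : i ∈ A (n + 1) ω
    swap
    · simp only [hiA, if_false, add_zero]
      linarith
    simp only [hiA, if_true]
    push_cast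
    rcases lt_or_ge (pulls A i n ω : ℝ) (4 * L * Real.log N / (ηM - η i) ^ 2) with hlt | hge
    · have := Finset.sum_nonneg fun t (_ : t ∈ Finset.Ico K n) => failures_nonneg L M X r η i t ω
      linarith
    suffices h : 1 ≤ failures L M X r η i n ω by linarith
    obtain ⟨j, hjM, hjA⟩ := exists_lt_notMem hMK (hA.card_eq (n + 1) (by omega) ω) hiA hi
    have hij := hA.highest n hKn ω i hiA j hjA
    -- Without failures, the index of `i` is below `η i` plus two widths, hence below `ηM ≤ η j`,
    -- which is below the index of `j`.
    by_contra hcon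
    have hhigh : ω ∉ highEvent L X r η i (pulls A i n ω) n := fun h =>
      hcon (one_le_failures (hA.pulls_mem_Icc hM hKn i ω) (Or.inl h))
    have hlow : ω ∉ lowEvent L X r η j (pulls A j n ω) n := fun h =>
      hcon (one_le_failures (hA.pulls_mem_Icc hM hKn j ω) (Or.inr ⟨j, hjM, h⟩))
    have hT : (1 : ℝ) ≤ pulls A i n ω := by
      exact_mod_cast (Finset.mem_Icc.1 (hA.pulls_mem_Icc hM hKn i ω)).1
    have hwidth : √(L * Real.log n / pulls A i n ω) ≤ (ηM - η i) / 2 := by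
      refine Real.sqrt_le_iff.2 ⟨by linarith, ?_⟩
      rw [div_le_iff₀ (by positivity)] at hge ⊢
      have hlog : Real.log n ≤ Real.log N :=
        Real.log_le_log (by exact_mod_cast (by omega : 0 < n)) (by exact_mod_cast (by omega))
      nlinarith [mul_le_mul_of_nonneg_left hlog hL]
    simp only [highEvent, lowEvent, Set.mem_ofPred_eq, not_le] at hhigh hlow
    simp only [ucbIndex] at hij
    linarith [hηM j hjM]

/-- With constant rewards and no exploration the index equals the mean, so after time `K` every
chosen set has maximal total mean. Only the deficit of the initial phase remains. -/
theorem IsUCBM.sum_top_sub_le_of_const (hA : IsUCBM M 0 X r 𝓤 A) (hM : 1 ≤ M) (hMK : M < K)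
    {η : Fin K → ℝ} (hr : ∀ i x, r i x = η i) {η₁ : ℝ} (hη₁ : ∀ i, η i ≤ η₁) {n : ℕ}
    (hKn : K ≤ n) (ω : Ω) :
    n * (∑ j : Fin K with j.val < M, η j) - ∑ i, η i * (pulls A i n ω : ℝ) ≤
      ∑ i : Fin K with M ≤ i.val, (η₁ - η i) * M := by
  induction n, hKn using Nat.le_induction with
  | base =>
    have := sum_top_sub_le hMK hη₁ (T := fun i => (pulls A i K ω : ℝ)) (n := K)
      (fun i => by exact_mod_cast pulls_le A i K ω) (sum_pulls hA.card_eq K ω)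
    simpa only [hA.init] using this
  | succ n hKn ih =>
    have hidx : ∀ i, ucbIndex 0 X r A i n ω = η i := fun i => by
      have h1 : (pulls A i n ω : ℝ) ≠ 0 := by
        have := (Finset.mem_Icc.1 (hA.pulls_mem_Icc hM hKn i ω)).1
        exact_mod_cast (by omega : pulls A i n ω ≠ 0)
      simp only [ucbIndex, sampleMean, hr, Finset.sum_const, Nat.card_Icc, Nat.add_sub_cancel,
        nsmul_eq_mul, zero_mul, zero_div, Real.sqrt_zero, add_zero]
      field_simp
    have hstep := sum_le_sum_of_forall_le (η := η)
      ((card_filter_val_lt hMK).trans (hA.card_eq (n + 1) (by omega) ω).symm)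
      fun i hi j hj => by
        have := hA.highest n hKn ω i hi j hj
        rwa [hidx, hidx] at this
    rw [sum_weight_mul_pulls_succ]
    push_cast
    linarith

end Counting

/-! ### Expected pull counts and decomposition of the regret. -/

section Expectation

variable {Ω S : Type*} {K M : ℕ} {𝓤 : MeasurableSpace Ω} [mΩ : MeasurableSpace Ω]
  [MeasurableSpace S] {μ : Measure Ω} [IsProbabilityMeasure μ] {P : Fin K → Kernel S S}
  [∀ i, IsMarkovKernel (P i)] {L : ℝ} {X : Fin K → ℕ → Ω → S} {r : Fin K → S → ℝ}
  {η ρ : Fin K → ℝ} {A : ℕ → Ω → Finset (Fin K)}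

theorem mul_sqrt_div {s a : ℝ} (hs : 0 < s) : s * √(a / s) = √(s * a) := by
  rw [show s * a = s ^ 2 * (a / s) by field_simp, Real.sqrt_mul (sq_nonneg s), Real.sqrt_sq hs.le]

theorem measurable_sampleMean (hX : ∀ i n, Measurable (X i n)) (hr : ∀ i, Measurable (r i))
    (i : Fin K) (s : ℕ) : Measurable (sampleMean X r i s) :=
  (Finset.measurable_sum _ fun t _ => (hr i).comp (hX i t)).div_const _

theorem measurableSet_lowEvent (hX : ∀ i n, Measurable (X i n)) (hr : ∀ i, Measurable (r i))
    (i : Fin K) (s t : ℕ) : MeasurableSet (lowEvent L X r η i s t) :=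
  measurableSet_le ((measurable_sampleMean hX hr i s).add_const _) measurable_const

theorem measurableSet_highEvent (hX : ∀ i n, Measurable (X i n)) (hr : ∀ i, Measurable (r i))
    (i : Fin K) (s t : ℕ) : MeasurableSet (highEvent L X r η i s t) :=
  measurableSet_le measurable_const (measurable_sampleMean hX hr i s)

/-- Multiplying by `s` turns both events into deviations of sums; the lower one is the upper one for
`-(r i - η i)`. -/
theorem measureReal_events_le {i : Fin K} (hX : IsMarkovChain μ (P i) (X i))
    (hr : Measurable (r i)) {C : ℝ} (hC : ∀ x, |r i x| ≤ C)
    (hρ : ∀ m x, |potential (P i) (fun y => r i y - η i) m x| ≤ ρ i) (hK : 2 ≤ K) (hL : 0 < L)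
    (hbound : ρ i + span (r i) ≤ √L / (1 / √(Real.log K) + 2 * √2)) {s t : ℕ} (ht : K ≤ t)
    (hs : 1 ≤ s) :
    μ.real (lowEvent L X r η i s t) ≤ 1 / (t : ℝ) ^ 4 ∧
      μ.real (highEvent L X r η i s t) ≤ 1 / (t : ℝ) ^ 4 := by
  obtain ⟨ω⟩ : Nonempty Ω := nonempty_of_isProbabilityMeasure μ
  have : Nonempty S := ⟨X i 0 ω⟩
  have hs0 : (0 : ℝ) < s := by exact_mod_cast hs
  have hspan := span_nonneg hC
  have hlow : μ (lowEvent L X r η i s t) ≤ ENNReal.ofReal (1 / (t : ℝ) ^ 4) := by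
    refine (measure_mono fun ω hω => ?_).trans (hX.measure_sqrt_le_sum_le (g := fun y => -(r i y - η i))
      (hr.sub_const _).neg (a := -((⨆ x, r i x) - η i)) (b := -((⨅ x, r i x) - η i)) (ρ := ρ i)
      (fun x => ?_) (fun m x => ?_) hK ht hs hL ?_ ?_)
    · simp only [lowEvent, sampleMean, Set.mem_ofPred_eq] at hω ⊢
      have h1 := mul_le_mul_of_nonneg_left hω hs0.le
      rw [mul_add, mul_sqrt_div hs0, mul_div_cancel₀ _ hs0.ne'] at h1
      simp only [neg_sub, Finset.sum_sub_distrib, Finset.sum_const, Nat.card_Icc,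
        Nat.add_sub_cancel, nsmul_eq_mul]
      linarith
    · have := mem_Icc_iInf_iSup hC x
      exact ⟨by linarith [this.2], by linarith [this.1]⟩
    · rw [potential_neg, abs_neg]
      exact hρ m x
    · unfold span at hbound
      linarith
    · unfold span at hspan
      linarith
  have hhigh : μ (highEvent L X r η i s t) ≤ ENNReal.ofReal (1 / (t : ℝ) ^ 4) := by
    refine (measure_mono fun ω hω => ?_).trans (hX.measure_sqrt_le_sum_le (g := fun y => r i y - η i)
      (hr.sub_const _) (a := (⨅ x, r i x) - η i) (b := (⨆ x, r i x) - η i) (ρ := ρ i)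
      (fun x => ?_) hρ hK ht hs hL ?_ ?_)
    · simp only [highEvent, sampleMean, Set.mem_ofPred_eq] at hω ⊢
      have h1 := mul_le_mul_of_nonneg_left hω hs0.le
      rw [mul_add, mul_sqrt_div hs0, mul_div_cancel₀ _ hs0.ne'] at h1
      simp only [Finset.sum_sub_distrib, Finset.sum_const, Nat.card_Icc,
        Nat.add_sub_cancel, nsmul_eq_mul]
      linarith
    · have := mem_Icc_iInf_iSup hC x
      exact ⟨by linarith [this.1], by linarith [this.2]⟩
    · unfold span at hbound
      linarith
    · unfold span at hspan
      linarith
  exact ⟨ENNReal.toReal_le_of_le_ofReal (by positivity) hlow,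
    ENNReal.toReal_le_of_le_ofReal (by positivity) hhigh⟩

theorem integrable_failures (hX : ∀ i n, Measurable (X i n)) (hr : ∀ i, Measurable (r i))
    (i : Fin K) (t : ℕ) : Integrable (failures L M X r η i t) μ :=
  integrable_finsetSum _ fun s _ => (integrable_finsetSum _ fun j _ =>
    (integrable_const (1 : ℝ)).indicator (measurableSet_lowEvent hX hr j s t)).add
    ((integrable_const (1 : ℝ)).indicator (measurableSet_highEvent hX hr i s t))

/-- Union bound over the `t` possible pull counts and `M + 1` events: `t (M + 1) t⁻⁴ ≤ 2 M t⁻²`. -/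
theorem integral_failures_le (hMK : M < K) (hM : 1 ≤ M) (hX : ∀ i n, Measurable (X i n))
    (hr : ∀ i, Measurable (r i)) {t : ℕ} (ht : 1 ≤ t)
    (h : ∀ i, ∀ s, 1 ≤ s → μ.real (lowEvent L X r η i s t) ≤ 1 / (t : ℝ) ^ 4 ∧
      μ.real (highEvent L X r η i s t) ≤ 1 / (t : ℝ) ^ 4) (i : Fin K) :
    ∫ ω, failures L M X r η i t ω ∂μ ≤ 2 * M * (1 / (t : ℝ) ^ 2) := by
  have hl : ∀ j s, Integrable ((lowEvent L X r η j s t).indicator (1 : Ω → ℝ)) μ := fun j s =>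
    (integrable_const (1 : ℝ)).indicator (measurableSet_lowEvent hX hr j s t)
  have hh : ∀ j s, Integrable ((highEvent L X r η j s t).indicator (1 : Ω → ℝ)) μ := fun j s =>
    (integrable_const (1 : ℝ)).indicator (measurableSet_highEvent hX hr j s t)
  have ht' : (1 : ℝ) ≤ t := by exact_mod_cast ht
  have hM' : (1 : ℝ) ≤ M := by exact_mod_cast hM
  simp only [failures]
  have hlh : ∀ s, Integrable (fun ω => ∑ j : Fin K with j.val < M,
      (lowEvent L X r η j s t).indicator (1 : Ω → ℝ) ω +
      (highEvent L X r η i s t).indicator (1 : Ω → ℝ) ω) μ := fun s =>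
    (integrable_finsetSum _ fun j _ => hl j s).add (hh i s)
  rw [integral_finsetSum _ fun s _ => hlh s]
  calc
    _ ≤ ∑ s ∈ Finset.Icc 1 t, ((M : ℝ) * (1 / (t : ℝ) ^ 4) + 1 / (t : ℝ) ^ 4) := by
        refine Finset.sum_le_sum fun s hs => ?_
        have hs1 := (Finset.mem_Icc.1 hs).1
        rw [integral_add (integrable_finsetSum _ fun j _ => hl j s) (hh i s),
          integral_finsetSum _ fun j _ => hl j s,
          integral_indicator_one (measurableSet_highEvent hX hr i s t)]
        refine add_le_add ?_ (h i s hs1).2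
        refine (Finset.sum_le_card_nsmul _ _ (1 / (t : ℝ) ^ 4) fun j _ => ?_).trans (le_of_eq ?_)
        · rw [integral_indicator_one (measurableSet_lowEvent hX hr j s t)]
          exact (h j s hs1).1
        · rw [card_filter_val_lt hMK, nsmul_eq_mul]
    _ = (M + 1) * (1 / (t : ℝ) ^ 3) := by
        rw [Finset.sum_const, Nat.card_Icc, Nat.add_sub_cancel, nsmul_eq_mul]
        field_simp
    _ ≤ 2 * M * (1 / (t : ℝ) ^ 2) := by
        refine mul_le_mul (by linarith) ?_ (by positivity) (by positivity)
        exact one_div_le_one_div_of_le (by positivity) (pow_le_pow_right₀ ht' (by norm_num))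

theorem sum_one_div_sq_le (K n : ℕ) (hK : 1 ≤ K) :
    ∑ t ∈ Finset.Ico K n, 1 / (t : ℝ) ^ 2 ≤ ∑' t : ℕ, 1 / ((t : ℝ) + 1) ^ 2 := by
  have hsum : Summable fun t : ℕ => 1 / ((t : ℝ) + 1) ^ 2 := by
    have := (summable_nat_add_iff 1).2 (Real.summable_one_div_nat_pow.2 (by norm_num : 1 < 2))
    simpa using this
  calc
    _ ≤ ∑ t ∈ Finset.Ico (0 + 1) (n + 1), 1 / (t : ℝ) ^ 2 := by
        refine Finset.sum_le_sum_of_subset_of_nonneg (fun t ht => ?_) fun t _ _ => by positivity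
        rw [Finset.mem_Ico] at ht ⊢
        omega
    _ = ∑ t ∈ Finset.Ico 0 n, 1 / ((t : ℝ) + 1) ^ 2 := by
        rw [← Finset.sum_Ico_add' (fun t : ℕ => 1 / (t : ℝ) ^ 2) 0 n 1]
        simp
    _ ≤ _ := hsum.sum_le_tsum _ fun t _ => by positivity

theorem integrable_pulls (h𝓤 : 𝓤 ≤ mΩ) (hX : ∀ i n, Measurable (X i n))
    (hA : ∀ n C, MeasurableSet[𝓤 ⊔ observed X A n] {ω | A (n + 1) ω = C}) (i : Fin K) (n : ℕ) :
    Integrable (fun ω => (pulls A i n ω : ℝ)) μ := by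
  have hm : Measurable (pulls A i n) := measurable_of_Iic fun s =>
    armInformation_le h𝓤 hX i s _ (measurableSet_pulls_le hA i n s)
  refine integrable_of_abs_le (measurable_from_top.comp hm) (C := n) fun ω => ?_
  rw [Nat.abs_cast]
  exact_mod_cast pulls_le A i n ω

theorem IsUCBM.integral_pulls_le (hA : IsUCBM M L X r 𝓤 A) (h𝓤 : 𝓤 ≤ mΩ) (hM : 1 ≤ M)
    (hMK : M < K) (hL : 0 < L) (hX : ∀ i, IsMarkovChain μ (P i) (X i))
    (hr : ∀ i, Measurable (r i)) (hC : ∀ i, ∃ C, ∀ x, |r i x| ≤ C)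
    (hρ : ∀ i m x, |potential (P i) (fun y => r i y - η i) m x| ≤ ρ i)
    (hbound : ∀ i, ρ i + span (r i) ≤ √L / (1 / √(Real.log K) + 2 * √2))
    {ηM : ℝ} (hηM : ∀ j : Fin K, j.val < M → ηM ≤ η j) {i : Fin K} (hi : M ≤ i.val)
    (hgap : η i < ηM) {n : ℕ} (hKn : K ≤ n) :
    ∫ ω, (pulls A i n ω : ℝ) ∂μ ≤ 4 * L * Real.log n / (ηM - η i) ^ 2 +
      (1 + 2 * ∑' t : ℕ, 1 / ((t : ℝ) + 1) ^ 2) * M := by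
  have hXm : ∀ i n, Measurable (X i n) := fun i => (hX i).1
  have hfi : ∀ t ∈ Finset.Ico K n, Integrable (failures L M X r η i t) μ := fun t _ =>
    integrable_failures hXm hr i t
  have h1 := integral_mono (integrable_pulls (μ := μ) h𝓤 hXm hA.nonanticipating i n)
    ((integrable_const (4 * L * Real.log n / (ηM - η i) ^ 2 + M)).add
      (integrable_finsetSum _ hfi))
    fun ω => (hA.pulls_le_add_sum_failures hM hMK hL.le hηM hi hgap hKn le_rfl ω).trans
      (le_of_eq (by simp only [Pi.add_apply]))
  simp only [Pi.add_apply] at h1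
  rw [integral_add (integrable_const _) (integrable_finsetSum _ hfi), integral_finsetSum _ hfi,
    integral_const, probReal_univ, one_smul] at h1
  have h2 : ∑ t ∈ Finset.Ico K n, ∫ ω, failures L M X r η i t ω ∂μ ≤
      2 * M * ∑' t : ℕ, 1 / ((t : ℝ) + 1) ^ 2 := by
    refine le_trans ?_ (mul_le_mul_of_nonneg_left (sum_one_div_sq_le K n (by omega))
      (by positivity))
    rw [Finset.mul_sum]
    refine Finset.sum_le_sum fun t ht => ?_
    have htK := (Finset.mem_Ico.1 ht).1
    refine integral_failures_le hMK hM hXm hr (by omega) (fun j s hs => ?_) i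
    obtain ⟨C, hC⟩ := hC j
    exact measureReal_events_le (hX j) (hr j) hC (hρ j) (by omega) hL (hbound j) htK hs
  linarith

/-- Write each reward as `η i` plus a centred part. Optional stopping at `T_i(n)` bounds the centred
total of arm `i` by `2 * ρ i` in expectation. -/
theorem regret_le (hA : ∀ n C, MeasurableSet[𝓤 ⊔ observed X A n] {ω | A (n + 1) ω = C})
    (h𝓤 : 𝓤 ≤ mΩ) (h𝓤_indep : Indep 𝓤
      (⨆ (i : Fin K) (n : ℕ), MeasurableSpace.comap (X i n) inferInstance) μ)
    (hX : ∀ i, IsMarkovChain μ (P i) (X i)) (hX_indep : iIndepFun (fun i ω n => X i n ω) μ)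
    (hr : ∀ i, Measurable (r i)) (hC : ∀ i, ∃ C, ∀ x, |r i x| ≤ C)
    (hρ : ∀ i m x, |potential (P i) (fun y => r i y - η i) m x| ≤ ρ i) (n : ℕ) :
    regret μ M η X r A n ≤ ∫ ω, (n * (∑ j : Fin K with j.val < M, η j) -
      ∑ i, η i * (pulls A i n ω : ℝ)) ∂μ + 2 * ∑ i, ρ i := by
  have hXm : ∀ i n, Measurable (X i n) := fun i => (hX i).1
  have hT : ∀ i, Integrable (fun ω => (pulls A i n ω : ℝ)) μ := fun i =>
    integrable_pulls h𝓤 hXm hA i n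
  have harm : ∀ i, Integrable
      (fun ω => ∑ s ∈ Finset.Icc 1 (pulls A i n ω), (r i (X i s ω) - η i)) μ ∧
      |∫ ω, ∑ s ∈ Finset.Icc 1 (pulls A i n ω), (r i (X i s ω) - η i) ∂μ| ≤ 2 * ρ i := fun i => by
    obtain ⟨C, hC⟩ := hC i
    exact abs_integral_stopped_sum_le (g := fun y => r i y - η i) (hXm i)
      (armInformation_le h𝓤 hXm i)
      (isTransition_armInformation hXm hX_indep h𝓤 h𝓤_indep i (hX i)) ((hr i).sub_const _)
      (C := C + |η i|) (fun x => (abs_sub _ _).trans (add_le_add (hC x) le_rfl)) (hρ i)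
      (pulls_le A i n) (measurableSet_pulls_le hA i n)
  have hpt : ∀ ω, ∑ t ∈ Finset.Icc 1 n, ∑ i ∈ A t ω, r i (X i (pulls A i t ω) ω) =
      ∑ i, ∑ s ∈ Finset.Icc 1 (pulls A i n ω), (r i (X i s ω) - η i) +
        ∑ i, η i * (pulls A i n ω : ℝ) := fun ω => by
    rw [sum_rewards_eq fun i s => r i (X i s ω), ← Finset.sum_add_distrib]
    refine Finset.sum_congr rfl fun i _ => ?_
    rw [Finset.sum_sub_distrib, Finset.sum_const, Nat.card_Icc, Nat.add_sub_cancel,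
      nsmul_eq_mul]
    ring
  have hTsum : Integrable (fun ω => ∑ i, η i * (pulls A i n ω : ℝ)) μ :=
    integrable_finsetSum _ fun i _ => (hT i).const_mul _
  have hbias : -(2 * ∑ i, ρ i) ≤
      ∑ i, ∫ ω, ∑ s ∈ Finset.Icc 1 (pulls A i n ω), (r i (X i s ω) - η i) ∂μ := by
    rw [Finset.mul_sum, ← Finset.sum_neg_distrib]
    exact Finset.sum_le_sum fun i _ => (abs_le.1 (harm i).2).1
  rw [regret]
  simp_rw [hpt]
  rw [integral_add (integrable_finsetSum _ fun i _ => (harm i).1) hTsum,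
    integral_finsetSum _ fun i _ => (harm i).1, integral_sub (integrable_const _) hTsum,
    integral_const, probReal_univ, one_smul]
  linarith

end Expectation

/-! ### Passage to extended reals. -/

section Bounds

variable {K M : ℕ}

theorem coe_le_coe_ofReal (x : ℝ) : (x : EReal) ≤ ((ENNReal.ofReal x : ℝ≥0∞) : EReal) := by
  rw [EReal.coe_ennreal_ofReal]
  exact EReal.coe_le_coe_iff.2 (le_max_left _ _)

theorem coe_le_of_le_add {x a b : ℝ} (y : ℝ≥0∞) (h : x ≤ a + b) :
    (x : EReal) ≤ ((y + ENNReal.ofReal a + ENNReal.ofReal b : ℝ≥0∞) : EReal) := by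
  refine (coe_le_coe_ofReal x).trans (EReal.coe_ennreal_le_coe_ennreal_iff.2 ?_)
  rw [add_assoc]
  exact (ENNReal.ofReal_le_ofReal h).trans (ENNReal.ofReal_add_le.trans le_add_self)

/-- A zero gap with positive `g i` makes the right side infinite, as `c > 0`. So the real inequality
is needed only when this does not occur. -/
theorem coe_le_gap_bound {ηM c x a b : ℝ} {g η : Fin K → ℝ} {s : Finset (Fin K)} (hc : 0 < c)
    (hg : ∀ i ∈ s, 0 ≤ g i)
    (h : (∀ i ∈ s, 0 < g i → ηM - η i ≠ 0) →
      x ≤ ∑ i ∈ s, g i * (c / (ηM - η i) ^ 2) + a + b) :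
    (x : EReal) ≤ ((ENNReal.ofReal c * (∑ i ∈ s, ENNReal.ofReal (g i) /
        ENNReal.ofReal ((ηM - η i) ^ 2)) + ENNReal.ofReal a + ENNReal.ofReal b : ℝ≥0∞) : EReal) := by
  by_cases hne : ∀ i ∈ s, 0 < g i → ηM - η i ≠ 0
  · have hsum : ENNReal.ofReal c * (∑ i ∈ s, ENNReal.ofReal (g i) /
        ENNReal.ofReal ((ηM - η i) ^ 2)) =
        ENNReal.ofReal (∑ i ∈ s, g i * (c / (ηM - η i) ^ 2)) := by
      rw [ENNReal.ofReal_sum_of_nonneg fun i hi => mul_nonneg (hg i hi) (by positivity),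
        Finset.mul_sum]
      refine Finset.sum_congr rfl fun i hi => ?_
      rcases (hg i hi).eq_or_lt with h0 | h0
      · simp [← h0]
      · have := hne i hi h0
        rw [← ENNReal.ofReal_div_of_pos (by positivity), ← ENNReal.ofReal_mul hc.le]
        congr 1
        ring
    rw [hsum]
    refine (coe_le_coe_ofReal x).trans (EReal.coe_ennreal_le_coe_ennreal_iff.2 ?_)
    exact (ENNReal.ofReal_le_ofReal (h hne)).trans
      (ENNReal.ofReal_add_le.trans (add_le_add ENNReal.ofReal_add_le le_rfl))
  · push Not at hne
    obtain ⟨i, hi, hgi, h0⟩ := hne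
    have htop : (∑ i ∈ s, ENNReal.ofReal (g i) / ENNReal.ofReal ((ηM - η i) ^ 2)) = ∞ :=
      ENNReal.sum_eq_top.2 ⟨i, hi, by
        rw [h0]
        simp [ENNReal.div_zero, hgi]⟩
    rw [htop, ENNReal.mul_top (by simpa using hc)]
    simp

end Bounds

end RestedBandit

end

/-! ### The regret bound. -/

theorem mainTheorem8
    {S : Type*} [TopologicalSpace S] [PolishSpace S] [MeasurableSpace S] [BorelSpace S]
    {Ω : Type*} (𝓤 : MeasurableSpace Ω) [mΩ : MeasurableSpace Ω] (μ : Measure Ω) [IsProbabilityMeasure μ]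
    (K M : ℕ) (hM : 1 ≤ M) (hMK : M < K)
    -- the arms: kernels, stationary laws, generators, rewards
    (P : Fin K → Kernel S S) [∀ i, IsMarkovKernel (P i)]
    (π : Fin K → Measure S) (F : Fin K → Set (S → ℝ))
    (hF : ∀ i, RestedBandit.IsBoundedClass (F i))
    (hdrift : ∀ i, RestedBandit.SubgeometricDrift (P i))
    (hconv : ∀ i, RestedBandit.ConvergesInIPM (F i) (P i) (π i))
    (r : Fin K → S → ℝ) (hr : ∀ i x, 0 ≤ r i x)
    (R : Fin K → ℝ) (hR : ∀ i, 0 ≤ R i) (hrF : ∀ i, r i ∈ R i • F i)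
    (Γ : Fin K → ℝ)
    (hΓ : ∀ i, Γ i = (RestedBandit.concentrability (F i) (P i) (π i)).toReal)
    (η : Fin K → ℝ) (hη : ∀ i, η i = ∫ x, r i x ∂(π i)) (hη_anti : Antitone η)
    -- independent state processes of the arms, and the independent randomization of the player
    (X : Fin K → ℕ → Ω → S)
    (hX : ∀ i, RestedBandit.IsMarkovChain μ (P i) (X i))
    (hX_indep : iIndepFun (fun i ω n => X i n ω) μ)
    (h𝓤 : 𝓤 ≤ mΩ)
    (h𝓤_indep : Indep 𝓤
      (⨆ (i : Fin K) (n : ℕ), MeasurableSpace.comap (X i n) inferInstance) μ)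
    -- the algorithm
    (L : ℝ)
    (hL : ∀ i, (R i * Γ i + RestedBandit.span (r i)) ^ 2 *
      (1 / √(Real.log K) + 2 * √2) ^ 2 ≤ L)
    (A : ℕ → Ω → Finset (Fin K)) (hA : RestedBandit.IsUCBM M L X r 𝓤 A)
    (β : ℝ) (hβ : β = ∑' t : ℕ, 1 / ((t : ℝ) + 1) ^ 2)
    (η₁ ηM : ℝ) (hη₁ : η₁ = η ⟨0, by omega⟩) (hηM : ηM = η ⟨M - 1, by omega⟩)
    (n : ℕ) :
    -- in `[0, ∞]`, with `a / 0 = ∞` for `a > 0` and `0 / 0 = 0`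
    (RestedBandit.regret μ M η X r A n : EReal) ≤
      ((ENNReal.ofReal (4 * L * Real.log n) *
            (∑ i : Fin K with M ≤ i.val,
              ENNReal.ofReal (η₁ - η i) / ENNReal.ofReal ((ηM - η i) ^ 2))
          + ENNReal.ofReal (∑ i : Fin K with M ≤ i.val, (η₁ - η i) * (1 + 2 * β) * M)
          + ENNReal.ofReal (2 * ∑ i, R i * Γ i) : ℝ≥0∞) : EReal) := by
  have hXm : ∀ i n, Measurable (X i n) := fun i => (hX i).1
  have hπ : ∀ i, IsProbabilityMeasure (π i) := fun i => (hconv i).1.1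
  have hrm : ∀ i, Measurable (r i) := fun i =>
    (RestedBandit.measurable_bounded_of_mem_smul (hF i) (hrF i)).1
  have hrC : ∀ i, ∃ C, ∀ x, |r i x| ≤ C := fun i =>
    (RestedBandit.measurable_bounded_of_mem_smul (hF i) (hrF i)).2
  have hρ : ∀ i m x, |RestedBandit.potential (P i) (fun y => r i y - η i) m x| ≤ R i * Γ i :=
    fun i m x => by
      rw [hη i, hΓ i]
      exact RestedBandit.abs_potential_le (hF i) (hconv i).2 (hR i) (hrF i) m x
  have hΓ0 : ∀ i, 0 ≤ R i * Γ i := fun i => by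
    rw [hΓ i]
    exact mul_nonneg (hR i) ENNReal.toReal_nonneg
  have hη₁' : ∀ i, η i ≤ η₁ := fun i => hη₁ ▸ hη_anti (Fin.mk_le_of_le_val (Nat.zero_le _))
  have hηM' : ∀ j : Fin K, j.val < M → ηM ≤ η j := fun j hj =>
    hηM ▸ hη_anti (Fin.le_def.2 (by simp only; omega))
  have hηM'' : ∀ i : Fin K, M ≤ i.val → η i ≤ ηM := fun i hi =>
    hηM ▸ hη_anti (Fin.le_def.2 (by simp only; omega))
  have hβ0 : 0 ≤ β := hβ ▸ tsum_nonneg fun t => by positivity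
  have hT : ∀ i, Integrable (fun ω => (RestedBandit.pulls A i n ω : ℝ)) μ := fun i =>
    RestedBandit.integrable_pulls h𝓤 hXm hA.nonanticipating i n
  have hTsum : Integrable (fun ω => n * (∑ j : Fin K with j.val < M, η j) -
      ∑ i, η i * (RestedBandit.pulls A i n ω : ℝ)) μ :=
    (integrable_const _).sub (integrable_finsetSum _ fun i _ => (hT i).const_mul _)
  have hregret := RestedBandit.regret_le (M := M) hA.nonanticipating h𝓤 h𝓤_indep hX hX_indep hrm
    hrC hρ n
  obtain ⟨ω₀⟩ : Nonempty Ω := nonempty_of_isProbabilityMeasure μ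
  have : Nonempty S := ⟨X ⟨0, by omega⟩ 0 ω₀⟩
  have hsp : ∀ i, 0 ≤ RestedBandit.span (r i) := fun i => by
    obtain ⟨C, hC⟩ := hrC i
    exact RestedBandit.span_nonneg hC
  have hc : 0 < 1 / √(Real.log K) + 2 * √2 := by positivity
  have hL0 : 0 ≤ L := (by positivity : (0 : ℝ) ≤ _).trans (hL ⟨0, by omega⟩)
  have hsplit : ∀ ω, n * (∑ j : Fin K with j.val < M, η j) -
      ∑ i, η i * (RestedBandit.pulls A i n ω : ℝ) ≤
      ∑ i : Fin K with M ≤ i.val, (η₁ - η i) * (RestedBandit.pulls A i n ω : ℝ) := fun ω =>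
    RestedBandit.sum_top_sub_le hMK hη₁' (fun i => by exact_mod_cast RestedBandit.pulls_le A i n ω)
      (RestedBandit.sum_pulls hA.card_eq n ω)
  have hconst : (∀ ω, n * (∑ j : Fin K with j.val < M, η j) -
      ∑ i, η i * (RestedBandit.pulls A i n ω : ℝ) ≤
      ∑ i : Fin K with M ≤ i.val, (η₁ - η i) * M) →
      (RestedBandit.regret μ M η X r A n) ≤
      ∑ i : Fin K with M ≤ i.val, (η₁ - η i) * (1 + 2 * β) * M + 2 * ∑ i, R i * Γ i := fun h => by
    have h1 := integral_mono hTsum (integrable_const _) h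
    rw [integral_const, probReal_univ, one_smul] at h1
    have h2 : ∑ i : Fin K with M ≤ i.val, (η₁ - η i) * (M : ℝ) ≤
        ∑ i : Fin K with M ≤ i.val, (η₁ - η i) * (1 + 2 * β) * M :=
      Finset.sum_le_sum fun i _ => mul_le_mul_of_nonneg_right
        (le_mul_of_one_le_right (sub_nonneg.2 (hη₁' i)) (by linarith)) (Nat.cast_nonneg M)
    linarith
  rcases lt_or_ge n K with hnK | hKn
  -- Before time `K` each arm has at most the `M` pulls of the initial phase, so the logarithmic
  -- term is not needed.
  · refine RestedBandit.coe_le_of_le_add _ (hconst fun ω => (hsplit ω).trans ?_)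
    refine Finset.sum_le_sum fun i _ => mul_le_mul_of_nonneg_left ?_ (sub_nonneg.2 (hη₁' i))
    rw [← hA.init i ω]
    exact_mod_cast RestedBandit.pulls_mono A i ω hnK.le
  -- For `L = 0` the logarithmic term vanishes even with ties, since `0 * ∞ = 0`. But then every
  -- span is zero and the rewards are constant.
  rcases hL0.eq_or_lt with rfl | hLpos
  · refine RestedBandit.coe_le_of_le_add _ (hconst fun ω => ?_)
    refine hA.sum_top_sub_le_of_const hM hMK (fun i x => ?_) hη₁' hKn ω
    obtain ⟨C, hC⟩ := hrC i
    have h0 : R i * Γ i + RestedBandit.span (r i) = 0 := by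
      have h1 := hL i
      have h2 : 0 < (1 / √(Real.log K) + 2 * √2) ^ 2 := by positivity
      exact pow_eq_zero_iff two_ne_zero |>.1
        (le_antisymm (nonpos_of_mul_nonpos_left h1 h2) (sq_nonneg _))
    have h1 : RestedBandit.span (r i) = 0 := by linarith [hΓ0 i, hsp i]
    have h2 : ∀ y, r i y = ⨅ z, r i z := fun y => by
      have := RestedBandit.mem_Icc_iInf_iSup hC y
      unfold RestedBandit.span at h1
      exact le_antisymm (by linarith [this.2]) this.1
    rw [hη i, h2 x, integral_congr_ae (.of_forall h2), integral_const, probReal_univ, one_smul]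
  · have hlog : 0 < Real.log n := Real.log_pos (by exact_mod_cast (by omega : 1 < n))
    refine RestedBandit.coe_le_gap_bound (by positivity) (fun i _ => sub_nonneg.2 (hη₁' i))
      fun hne => ?_
    have hbound : ∀ i, R i * Γ i + RestedBandit.span (r i) ≤
        √L / (1 / √(Real.log K) + 2 * √2) := fun i => by
      rw [le_div_iff₀ hc]
      refine Real.le_sqrt_of_sq_le ?_
      rw [mul_pow]
      exact hL i
    have h1 := integral_mono hTsum
      (integrable_finsetSum _ fun i _ => (hT i).const_mul (η₁ - η i)) hsplit
    rw [integral_finsetSum _ fun i _ => (hT i).const_mul (η₁ - η i)] at h1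
    have h2 : ∑ i : Fin K with M ≤ i.val,
        ∫ ω, (η₁ - η i) * (RestedBandit.pulls A i n ω : ℝ) ∂μ ≤
        ∑ i : Fin K with M ≤ i.val, ((η₁ - η i) * (4 * L * Real.log n / (ηM - η i) ^ 2) +
          (η₁ - η i) * (1 + 2 * β) * M) := by
      refine Finset.sum_le_sum fun i hi => ?_
      have hMi := (Finset.mem_filter.1 hi).2
      rw [integral_const_mul, mul_assoc (η₁ - η i) (1 + 2 * β), ← mul_add]
      -- An arm with `η i = η₁` costs nothing, however often it is played; for the others `hne`
      -- makes the gap to `ηM` strict.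
      rcases (sub_nonneg.2 (hη₁' i)).eq_or_lt with h0 | h0
      · simp [← h0]
      · refine mul_le_mul_of_nonneg_left ?_ h0.le
        rw [hβ]
        exact hA.integral_pulls_le h𝓤 hM hMK hLpos hX hrm hrC hρ hbound hηM' hMi
          (lt_of_le_of_ne (hηM'' i hMi) fun h => hne i hi h0 (sub_eq_zero.2 h.symm)) hKn
    rw [Finset.sum_add_distrib] at h2
    linarith
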